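/- Let $n \ge 2$ be an integer and let $Q_n$ be the $n$-dimensional hypercube, i.e. the graph whose vertices are the binary strings of length $n$, two strings being adjacent if and only if they differ in exactly one position. Let $M$ be a matching of $Q_n$, i.e. a set of edges of $Q_n$ no two of which share a vertex, with $|M| \le 2n-1$. Then there exists a Hamiltonian cycle of $Q_n$ containing every edge of $M$. -/

import Mathlib

/-- The `n`-dimensional hypercube: the vertices are the binary strings of length `n`, and two
vertices are adjacent when they differ in exactly one position. -/
def hypercubeGraph (n : ℕ) : SimpleGraph (Fin n → Bool) where
  Adj u v := hammingDist u v = 1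
  symm := ⟨fun u v h => by rw [hammingDist_comm]; exact h⟩
  loopless := ⟨fun u h => by simp at h⟩

/-- A finite set of edges of `G` is a matching if no two distinct members share a vertex. -/
def IsEdgeMatching {V : Type*} (G : SimpleGraph V) (M : Finset (Sym2 V)) : Prop :=
  (∀ e ∈ M, e ∈ G.edgeSet) ∧ ∀ e ∈ M, ∀ f ∈ M, e ≠ f → ∀ v, v ∈ e → v ∉ f

/-! A Hamiltonian cycle is handled as two perfect matchings `f`, `r`, encoded as involutions, such
that no proper nonempty vertex set is closed under both. Two ingredients carry the proof.

The first is Fink's theorem (`completable_hypercubeGraph`): any perfect matching of the complete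
graph on the vertices of the cube is completed to a Hamiltonian cycle by a perfect matching of the
cube. It is proved by splitting the cube: a spanning path system in one half is contracted to a
matching of the other half, which is completed there by induction (`exists_completion_of_half`).

The second is a simultaneous induction on the dimension (`extends_hypercubeGraph`). Counting covered
vertices instead of edges, the bound `2n - 1` becomes `4n - 2`. The companion statement
`ExtendsWithEdge` takes at most `2n` covered vertices and one more prescribed edge with an uncovered
end; its other end may be covered, so the edges need not form a matching. In the induction step,
averaging over directions gives one that contains at most one matching edge, and the cube is split
there.

If the fuller half is within the inductive bound, it has a Hamiltonian cycle `C` through its edges.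
An edge `vy` of `C` is chosen outside the matching, with `v` uncovered in the other half and in the
column of the crossing edge, if there is one. The companion statement gives a cycle of the other
half through `vy`, and the two cycles merge by exchanging both copies of `vy` for vertical edges
(`HamPair.exists_merge`).

If the fuller half exceeds the bound, at most one edge lies elsewhere. When both halves fit into one
matching of the base, copying that matching to both halves and adding vertical edges elsewhere gives
a perfect matching to which Fink's theorem applies (`extends_of_copies`). Otherwise one edge is
dropped from the fuller half and restored by rotating the resulting cycle at that chord. This leaves
a Hamiltonian path, which is closed up through the other half (`HamPair.exists_rotation`,
`exists_hamPair_rotation`). -/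

namespace HypercubeMatching
open Function

/-! ### Orbits of two involutions and parity -/

section Involutions
variable {X : Type*}

/-- Only the full set is nonempty and closed under both `f` and `g`. -/
def JointlyTransitive (f g : X → X) : Prop :=
  ∀ S : Set X, S.Nonempty → Set.MapsTo f S S → Set.MapsTo g S S → S = Set.univ

theorem JointlyTransitive.symm {f g : X → X} (h : JointlyTransitive f g) :
    JointlyTransitive g f :=
  fun S hS hg hf => h S hS hf hg

theorem mapsTo_compl_of_involutive {f : X → X} (hf : Involutive f) {S : Set X}
    (h : Set.MapsTo f S S) : Set.MapsTo f Sᶜ Sᶜ := by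
  intro x hx hfx
  apply hx
  have := h hfx
  rwa [hf x] at this

theorem even_card_of_involutive (C : Finset X) (f : X → X) (hf : Involutive f)
    (hC : ∀ x ∈ C, f x ∈ C) (hne : ∀ x ∈ C, f x ≠ x) : Even C.card := by
  have h : ∑ x ∈ C, (1 : ZMod 2) = 0 := by
    refine Finset.sum_involution (fun x _ => f x) ?_ ?_ ?_ ?_
    · intro a _; decide
    · intro a ha _; exact hne a ha
    · intro a ha; exact hC a ha
    · intro a _; exact hf a
  simp only [Finset.sum_const, nsmul_eq_mul, mul_one] at h
  exact (ZMod.natCast_eq_zero_iff_even).1 h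

open Classical in
/-- A finite set all of whose classes are even can be paired up inside the classes. -/
theorem exists_pairing (r : Setoid X) (U : Finset X)
    (hU : ∀ u ∈ U, Even (U.filter (fun v => r u v)).card) :
    ∃ s : X → X, Involutive s ∧ (∀ x, x ∉ U → s x = x) ∧
      ∀ x ∈ U, s x ∈ U ∧ s x ≠ x ∧ r x (s x) := by
  induction U using Finset.strongInduction with
  | H U ih =>
    rcases U.eq_empty_or_nonempty with rfl | ⟨u, hu⟩
    · exact ⟨id, fun _ => rfl, fun _ _ => rfl, by simp⟩
    · have hmem : u ∈ U.filter (fun v => r u v) := by simp [hu]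
      obtain ⟨v, hv, hvu⟩ : ∃ v ∈ U.filter (fun v => r u v), v ≠ u := by
        by_contra! hcon
        have : U.filter (fun v => r u v) = {u} :=
          Finset.eq_singleton_iff_unique_mem.2 ⟨hmem, hcon⟩
        have h2 := hU u hu
        rw [this] at h2
        simp at h2
      simp only [Finset.mem_filter] at hv
      obtain ⟨hvU, huv⟩ := hv
      set U' := (U.erase u).erase v with hU'
      have hss : U' ⊂ U :=
        lt_of_le_of_lt (Finset.erase_subset _ _) (Finset.erase_ssubset hu)
      obtain ⟨s, hs1, hs2, hs3⟩ := ih U' hss (by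
        intro t ht
        have htU : t ∈ U := hss.1 ht
        by_cases htu : r t u
        · have htv : r t v := r.trans htu huv
          have h1 : U'.filter (fun w => r t w)
              = ((U.filter (fun w => r t w)).erase u).erase v := by
            ext w; simp only [hU', Finset.mem_filter, Finset.mem_erase]; tauto
          rw [h1, Finset.card_erase_of_mem (by simp [hvU, htv, hvu]),
            Finset.card_erase_of_mem (by simp [hu, htu])]
          have := hU t htU
          grind
        · have htv : ¬ r t v := fun h => htu (r.trans h (r.symm huv))
          have h1 : U'.filter (fun w => r t w) = U.filter (fun w => r t w) := by
            ext w
            simp only [hU', Finset.mem_filter, Finset.mem_erase]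
            constructor
            · tauto
            · rintro ⟨hw, hw'⟩
              refine ⟨⟨?_, ?_, hw⟩, hw'⟩ <;> rintro rfl <;> contradiction
          rw [h1]; exact hU t htU)
      have hsu : s u = u := hs2 u (by simp [hU'])
      have hsv : s v = v := hs2 v (by simp [hU'])
      have hU'mem : ∀ x, x ∈ U' ↔ x ≠ v ∧ x ≠ u ∧ x ∈ U := by
        intro x; simp [hU']
      refine ⟨fun x => if x = u then v else if x = v then u else s x, ?_, ?_, ?_⟩
      · intro x
        have := hs1 x
        grind
      · intro x hx
        have := hs2 x (fun h => hx (hss.1 h))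
        grind
      · intro x hx
        by_cases hxu : x = u
        · subst hxu; simp [hvU, hvu, huv]
        · by_cases hxv : x = v
          · subst hxv; simp [hu, hxu, r.symm huv]; exact Ne.symm hxu
          · have h1 := hs3 x ((hU'mem x).2 ⟨hxv, hxu, hx⟩)
            simp only [hxu, hxv, if_false]
            exact ⟨hss.1 h1.1, h1.2⟩

/-- If `q` is a fixed-point-free involution and `p` an involution of a finite type, the fixed
points of `p` can be paired inside the orbits of `p` and `q`. -/
theorem exists_pairing_fixedPoints [Finite X] (p q : X → X) (hp : Involutive p)
    (hq : Involutive q) (hqne : ∀ x, q x ≠ x) :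
    ∃ s : X → X, Involutive s ∧ (∀ x, p x ≠ x → s x = x) ∧
      (∀ x, p x = x → s x ≠ x ∧ p (s x) = s x) ∧
      ∀ S : Set X, Set.MapsTo p S S → Set.MapsTo q S S → Set.MapsTo s S S := by
  classical
  have := Fintype.ofFinite X
  -- Being in the same orbit is expressed through closed sets; symmetry holds because complements of
  -- closed sets are closed.
  let r : Setoid X :=
    { r := fun x y => ∀ S : Set X, Set.MapsTo p S S → Set.MapsTo q S S → x ∈ S → y ∈ S
      iseqv :=
        { refl := fun x S _ _ h => h
          symm := fun {x y} h S h1 h2 hy => by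
            by_contra hx
            exact h Sᶜ (mapsTo_compl_of_involutive hp h1) (mapsTo_compl_of_involutive hq h2) hx hy
          trans := fun h h' S h1 h2 hx => h' S h1 h2 (h S h1 h2 hx) } }
  have hr : ∀ x y, r x y ↔
    ∀ S : Set X, Set.MapsTo p S S → Set.MapsTo q S S → x ∈ S → y ∈ S := fun _ _ => Iff.rfl
  have hrp : ∀ x, r x (p x) := fun x S h1 h2 hx => h1 hx
  have hrq : ∀ x, r x (q x) := fun x S h1 h2 hx => h2 hx
  obtain ⟨s, hs1, hs2, hs3⟩ := exists_pairing r (Finset.univ.filter (fun x => p x = x)) (by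
    intro u _
    have h1 : Even (Finset.univ.filter (fun v => r u v)).card := by
      refine even_card_of_involutive _ q hq ?_ (fun x _ => hqne x)
      intro x hx
      simp only [Finset.mem_filter, Finset.mem_univ, true_and] at hx ⊢
      exact r.trans hx (hrq x)
    have h2 : Even ((Finset.univ.filter (fun v => r u v)).filter (fun v => ¬ p v = v)).card := by
      refine even_card_of_involutive _ p hp ?_ (fun x hx => (Finset.mem_filter.1 hx).2)
      intro x hx
      simp only [Finset.mem_filter, Finset.mem_univ, true_and] at hx ⊢
      refine ⟨r.trans hx.1 (hrp x), fun h => hx.2 ?_⟩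
      rw [hp x] at h
      exact h.symm
    -- An orbit is even because `q` has no fixed point, and its points moved by `p` are even in
    -- number; hence so are the points fixed by `p`. Parity replaces the description of orbits as
    -- paths and cycles.
    have h3 := Finset.card_filter_add_card_filter_not
      (s := Finset.univ.filter (fun v => r u v)) (fun v => p v = v)
    rw [Finset.filter_filter, Finset.filter_congr (fun x _ => and_comm),
      ← Finset.filter_filter] at h3
    grind)
  refine ⟨s, hs1, fun x hx => hs2 x (by simpa using hx), ?_, ?_⟩
  · intro x hx
    have := hs3 x (by simpa using hx)
    simp only [Finset.mem_filter, Finset.mem_univ, true_and] at this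
    exact ⟨this.2.1, this.1⟩
  · intro S h1 h2 x hx
    by_cases h : p x = x
    · exact (hs3 x (by simpa using h)).2.2 S h1 h2 hx
    · rw [hs2 x (by simpa using h)]; exact hx

/-- An orbit containing one of exactly two fixed points contains the other. -/
theorem mem_of_two_fixedPoints [Finite X] {p q : X → X} (hp : Involutive p)
    (hq : Involutive q) (hqne : ∀ x, q x ≠ x) {a b : X}
    (hab : ∀ x, p x = x ↔ x = a ∨ x = b) {S : Set X} (h1 : Set.MapsTo p S S)
    (h2 : Set.MapsTo q S S) (ha : a ∈ S) : b ∈ S := by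
  obtain ⟨s, -, -, hs, hS⟩ := exists_pairing_fixedPoints p q hp hq hqne
  obtain ⟨h3, h4⟩ := hs a ((hab a).2 (Or.inl rfl))
  have h5 := (hab _).1 h4
  have h6 := hS S h1 h2 ha
  rcases h5 with h5 | h5
  · exact absurd h5 h3
  · rwa [h5] at h6

end Involutions

/-! ### Prisms and completing a matching from one half to the other -/

section Prism
variable {W : Type*} {G : SimpleGraph W}

/-- Two copies of a graph with corresponding vertices joined. -/
def prism (G : SimpleGraph W) : SimpleGraph (Bool × W) where
  Adj p q := (p.1 = q.1 ∧ G.Adj p.2 q.2) ∨ (p.1 ≠ q.1 ∧ p.2 = q.2)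
  symm := ⟨fun _ _ h => h.imp (fun h => ⟨h.1.symm, h.2.symm⟩) (fun h => ⟨h.1.symm, h.2.symm⟩)⟩
  loopless := ⟨fun p h => by rcases h with h | h <;> simp at h⟩

/-- Every perfect matching of the complete graph on the vertices of `G` is completed to a
Hamiltonian cycle by a perfect matching of `G`. -/
def Completable (G : SimpleGraph W) : Prop :=
  ∀ f : W → W, Involutive f → (∀ x, f x ≠ x) →
    ∃ r : W → W, Involutive r ∧ (∀ x, G.Adj x (r x)) ∧ JointlyTransitive f r

/-- The part of a map of `Bool × W` that stays in one copy of `W`. -/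
def half [DecidableEq W] (m : Bool × W → Bool × W) (b : Bool) (x : W) : W :=
  if (m (b, x)).1 = b then (m (b, x)).2 else x

variable [DecidableEq W]

theorem half_involutive {m : Bool × W → Bool × W} (hm : Involutive m) (b : Bool) :
    Involutive (half m b) := by
  intro x
  have := hm (b, x)
  unfold half
  rcases h : m (b, x) with ⟨c, y⟩
  rw [h] at this
  by_cases hc : c = b
  · subst hc; simp [this]
  · simp [hc, h]

/-- The edges of `F` inside the first copy together with `q` form paths whose ends are matched by
`F` into the second copy. Replacing each path and its two crossing edges by a single edge yields a
perfect matching `h` on the second copy, which `hG` completes by `r`. Expanding the paths again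
preserves transitivity, since `hhit` makes every orbit of the first copy reach the second. -/
theorem exists_completion_of_half [Finite W] (hG : Completable G)
    (F : Bool × W → Bool × W) (hF : Involutive F) (hFne : ∀ x, F x ≠ x)
    (q : W → W) (hq : Involutive q) (hqne : ∀ x, q x ≠ x)
    (hhit : ∀ S : Set W, S.Nonempty → Set.MapsTo (half F false) S S → Set.MapsTo q S S →
      ∃ x ∈ S, (F (false, x)).1 = true) :
    ∃ r : W → W, Involutive r ∧ (∀ x, G.Adj x (r x)) ∧
      JointlyTransitive F (fun p => (p.1, if p.1 then r p.2 else q p.2)) := by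
  set p := half F false with hp
  have hpfix : ∀ x, p x = x ↔ (F (false, x)).1 = true := by
    intro x
    have := hFne (false, x)
    rw [hp]; unfold half
    rcases h : F (false, x) with ⟨c, y⟩
    rw [h] at this
    cases c
    · simpa using this
    · simp
  obtain ⟨s, hs1, hs2, hs3, hs4⟩ :=
    exists_pairing_fixedPoints p q (half_involutive hF false) hq hqne
  -- the matching induced on the second copy
  let h : W → W := fun x => if (F (true, x)).1 = true then (F (true, x)).2 else
    (F (false, s (F (true, x)).2)).2
  have key : ∀ x, (F (true, x)).1 = false → ∃ z y, F (true, x) = (false, z) ∧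
      F (false, z) = (true, x) ∧ s z ≠ z ∧ F (false, s z) = (true, y) ∧
      F (true, y) = (false, s z) ∧ h x = y := by
    intro x hx
    have e1 : F (true, x) = (false, (F (true, x)).2) := by rw [← hx]
    set z := (F (true, x)).2 with hz
    have e2 : F (false, z) = (true, x) := by rw [← e1, hF]
    have e3 := hs3 z ((hpfix z).2 (by rw [e2]))
    have e4 := (hpfix _).1 e3.2
    have e5 : F (false, s z) = (true, (F (false, s z)).2) := by rw [← e4]
    refine ⟨z, (F (false, s z)).2, e1, e2, e3.1, e5, by rw [← e5, hF], ?_⟩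
    simp only [h, hx]
    simp [hz]
  have hh : Involutive h := by
    intro x
    cases hx : (F (true, x)).1
    · obtain ⟨z, y, e1, e2, e3, e4, e5, e6⟩ := key x hx
      rw [e6]
      simp only [h, e5]
      simp [hs1 z, e2]
    · have e1 : F (true, x) = (true, (F (true, x)).2) := Prod.ext hx rfl
      have e2 : F (true, (F (true, x)).2) = (true, x) := by rw [← e1, hF]
      simp only [h, hx, if_true, e2]
  have hhne : ∀ x, h x ≠ x := by
    intro x hxx
    cases hx : (F (true, x)).1
    · obtain ⟨z, y, e1, e2, e3, e4, e5, e6⟩ := key x hx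
      rw [hxx] at e6
      subst e6
      rw [e1] at e5
      exact e3 (by simpa using e5.symm)
    · have e1 : F (true, x) = (true, (F (true, x)).2) := Prod.ext hx rfl
      simp only [h, hx, if_true] at hxx
      rw [hxx] at e1
      exact hFne _ e1
  obtain ⟨r, hr1, hr2, hr3⟩ := hG h hh hhne
  refine ⟨r, hr1, hr2, ?_⟩
  intro S hS hSF hSR
  let S0 : Set W := {x | (false, x) ∈ S}
  let S1 : Set W := {x | (true, x) ∈ S}
  have hS0q : Set.MapsTo q S0 S0 := fun x hx => by simpa [S0] using hSR hx
  have hS1r : Set.MapsTo r S1 S1 := fun x hx => by simpa [S1] using hSR hx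
  have hS0p : Set.MapsTo p S0 S0 := by
    intro x hx
    have h1 := hSF (show (false, x) ∈ S from hx)
    rw [hp]; unfold half
    split_ifs with h2
    · have e1 : F (false, x) = (false, (F (false, x)).2) := Prod.ext h2 rfl
      show (false, (F (false, x)).2) ∈ S
      rwa [← e1]
    · exact hx
  have hS0s := hs4 S0 hS0p hS0q
  have hcross : ∀ x ∈ S0, (F (false, x)).1 = true → (F (false, x)).2 ∈ S1 := by
    intro x hx h2
    have h1 := hSF (show (false, x) ∈ S from hx)
    have e1 : F (false, x) = (true, (F (false, x)).2) := Prod.ext h2 rfl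
    show (true, (F (false, x)).2) ∈ S
    rwa [← e1]
  have hS1h : Set.MapsTo h S1 S1 := by
    intro x hx
    cases h2 : (F (true, x)).1
    · obtain ⟨z, y, e1, e2, e3, e4, e5, e6⟩ := key x h2
      rw [e6]
      have hz : z ∈ S0 := by
        have := hSF (show (true, x) ∈ S from hx)
        rwa [e1] at this
      have := hcross _ (hS0s hz) (by rw [e4])
      rwa [e4] at this
    · have h1 := hSF (show (true, x) ∈ S from hx)
      show (true, h x) ∈ S
      simp only [h, h2, if_true]
      have e1 : F (true, x) = (true, (F (true, x)).2) := Prod.ext h2 rfl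
      rwa [← e1]
  have hne1 : S1.Nonempty := by
    obtain ⟨⟨b, x⟩, hx⟩ := hS
    cases b
    · obtain ⟨y, hy, hy'⟩ := hhit S0 ⟨x, hx⟩ hS0p hS0q
      exact ⟨_, hcross y hy hy'⟩
    · exact ⟨x, hx⟩
  have h1 : S1 = Set.univ := hr3 S1 hne1 hS1h hS1r
  -- The complement of `S0` is also closed, so if nonempty it would contain a crossing vertex. Its
  -- partner lies in `S1`, and applying `F` once more gives a contradiction.
  have h0 : S0 = Set.univ := by
    by_contra hcon
    obtain ⟨y, hy, hy'⟩ := hhit S0ᶜ (Set.nonempty_compl.2 hcon)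
      (mapsTo_compl_of_involutive (half_involutive hF false) hS0p)
      (mapsTo_compl_of_involutive hq hS0q)
    have h2 : (F (false, y)).2 ∈ S1 := by rw [h1]; trivial
    have h3 := hSF (show (true, (F (false, y)).2) ∈ S from h2)
    rw [← hy', Prod.mk.eta, hF] at h3
    exact hy h3
  ext ⟨b, x⟩
  simp only [Set.mem_univ, iff_true]
  cases b
  · have : x ∈ S0 := by rw [h0]; trivial
    exact this
  · have : x ∈ S1 := by rw [h1]; trivial
    exact this

end Prism

/-! ### Fink's theorem for the hypercube -/

section Completion
variable {W : Type*} {G : SimpleGraph W}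

theorem JointlyTransitive.conj {X Y : Type*} (e : X ≃ Y) {f g : Y → Y}
    (h : JointlyTransitive f g) :
    JointlyTransitive (e.symm ∘ f ∘ e) (e.symm ∘ g ∘ e) := by
  intro S hS hf hg
  have h1 := h (e.symm ⁻¹' S) (by
      obtain ⟨x, hx⟩ := hS
      exact ⟨e x, by simpa using hx⟩)
    (fun y hy => by simpa using hf hy) (fun y hy => by simpa using hg hy)
  ext x
  have h2 : e x ∈ e.symm ⁻¹' S := by rw [h1]; trivial
  simpa using h2

theorem involutive_conj {X Y : Type*} (e : X ≃ Y) {f : Y → Y} (h : Involutive f) :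
    Involutive (e.symm ∘ f ∘ e) := by
  intro x; simp [h _]

/-- `Completable` is used twice: on the first copy, after pairing its crossing vertices arbitrarily,
and on the second copy through `exists_completion_of_half`. Without a crossing edge the two copies
could not be connected by `F`, whence `hcr`. -/
theorem exists_completion_prism [DecidableEq W] [Fintype W] (hG : Completable G)
    (hW : Even (Fintype.card W)) (F : Bool × W → Bool × W) (hF : Involutive F)
    (hFne : ∀ x, F x ≠ x) (hcr : ∃ x, (F x).1 ≠ x.1) :
    ∃ r : Bool × W → Bool × W, Involutive r ∧ (∀ x, (prism G).Adj x (r x)) ∧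
      JointlyTransitive F r := by
  classical
  set p := half F false with hp
  have hpi : Involutive p := half_involutive hF false
  have hpfix : ∀ x, p x = x ↔ (F (false, x)).1 = true := by
    intro x
    have := hFne (false, x)
    rw [hp]; unfold half
    rcases h : F (false, x) with ⟨c, y⟩
    rw [h] at this
    cases c
    · simpa using this
    · simp
  have hcr' : ∃ x, (F (false, x)).1 = true := by
    obtain ⟨⟨b, x⟩, hx⟩ := hcr
    cases b
    · exact ⟨x, by simpa using hx⟩
    · refine ⟨(F (true, x)).2, ?_⟩
      have e1 : F (true, x) = (false, (F (true, x)).2) := Prod.ext (by simpa using hx) rfl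
      rw [← e1, hF]
  obtain ⟨s, hs1, hs2, hs3⟩ := exists_pairing (⊤ : Setoid W)
    (Finset.univ.filter (fun x => p x = x)) (by
      intro u _
      have h2 : Even (Finset.univ.filter (fun v => ¬ p v = v)).card := by
        refine even_card_of_involutive _ p hpi ?_ (fun x hx => (Finset.mem_filter.1 hx).2)
        intro x hx
        simp only [Finset.mem_filter, Finset.mem_univ, true_and] at hx ⊢
        intro h
        rw [hpi x] at h
        exact hx h.symm
      have h3 := Finset.card_filter_add_card_filter_not
        (s := (Finset.univ : Finset W)) (fun v => p v = v)
      have h4 : (Finset.univ.filter (fun x => p x = x)).filter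
          (fun v => (⊤ : Setoid W) u v) = Finset.univ.filter (fun x => p x = x) :=
        Finset.filter_true_of_mem (fun _ _ => trivial)
      rw [h4]
      rw [Finset.card_univ] at h3
      grind)
  have hs2' : ∀ x, p x ≠ x → s x = x := fun x hx => hs2 x (by simpa using hx)
  have hs3' : ∀ x, p x = x → p (s x) = s x ∧ s x ≠ x := fun x hx => by
    have := hs3 x (by simpa using hx)
    simp only [Finset.mem_filter, Finset.mem_univ, true_and] at this
    exact ⟨this.1, this.2.1⟩
  -- The auxiliary pairs of `s` turn the first half into a perfect matching. Dropping them from the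
  -- completed cycle leaves paths ending at crossing vertices; an orbit without such a vertex would
  -- have been the whole cycle.
  obtain ⟨q, hq1, hq2, hq3⟩ := hG (fun x => if p x = x then s x else p x)
    (by
      intro x
      by_cases hx : p x = x
      · have := hs3' x hx
        simp [hx, this.1, hs1 x]
      · have : p (p x) ≠ p x := by rw [hpi x]; exact Ne.symm hx
        simp [hx, hpi x, Ne.symm hx])
    (by
      intro x
      by_cases hx : p x = x
      · simp [hx, (hs3' x hx).2]
      · simp [hx])
  obtain ⟨r, hr1, hr2, hr3⟩ := exists_completion_of_half hG F hF hFne q hq1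
    (fun x => (hq2 x).ne') (by
      intro S hS h1 h2
      by_contra! hcon
      have h3 := hq3 S hS (by
        intro x hx
        have : ¬ p x = x := fun h => hcon x hx ((hpfix x).1 h)
        simp only [this, if_false]
        exact h1 hx) h2
      obtain ⟨x, hx⟩ := hcr'
      exact hcon x (by rw [h3]; trivial) hx)
  refine ⟨_, ?_, ?_, hr3⟩
  · rintro ⟨b, x⟩
    cases b
    · simp [hq1 x]
    · simp [hr1 x]
  · rintro ⟨b, x⟩
    left
    cases b
    · simpa using hq2 x
    · simpa using hr2 x

theorem hammingDist_removeNth {n : ℕ} (i : Fin (n + 1)) (v w : Fin (n + 1) → Bool) :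
    hammingDist v w = (if v i = w i then 0 else 1) +
      hammingDist (i.removeNth v) (i.removeNth w) := by
  unfold hammingDist
  rw [Finset.card_filter, Finset.card_filter, Fin.sum_univ_succAbove _ i]
  congr 1
  by_cases h : v i = w i <;> simp [h]

/-- Splitting the hypercube along the coordinate `i`; `b` selects which half comes first. -/
def splitIso {n : ℕ} (i : Fin (n + 1)) (b : Bool) :
    hypercubeGraph (n + 1) ≃g prism (hypercubeGraph n) where
  toFun v := (xor b (v i), i.removeNth v)
  invFun p := i.insertNth (xor b p.1) p.2
  left_inv v := by simp
  right_inv p := by simp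
  map_rel_iff' {v w} := by
    have h := hammingDist_removeNth i v w
    simp only [prism, hypercubeGraph, Equiv.coe_fn_mk]
    rw [h]
    by_cases h1 : v i = w i
    · simp [h1]
    · simp only [h1, if_false]
      have : ¬ (b ^^ v i) = (b ^^ w i) := by simpa using h1
      simp only [this, false_and, false_or, ne_eq, not_false_eq_true, true_and]
      rw [← hammingDist_eq_zero]
      omega

theorem splitIso_fst {n : ℕ} (i : Fin (n + 1)) (b : Bool) (v : Fin (n + 1) → Bool) :
    (splitIso i b v).1 = xor b (v i) := rfl

theorem completable_hypercubeGraph (n : ℕ) : Completable (hypercubeGraph n) := by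
  induction n with
  | zero =>
    intro f _ hf
    exact absurd (Subsingleton.elim _ _) (hf default)
  | succ n ih =>
    intro f hf hfne
    have hv := hfne default
    obtain ⟨i, hi⟩ := Function.ne_iff.1 hv
    -- The prism step needs an even base, so dimension one is separate: there `f` is the only edge,
    -- and it completes itself.
    rcases Nat.eq_zero_or_pos n with rfl | hn
    · have hadj : ∀ x, (hypercubeGraph 1).Adj x (f x) := by
        intro x
        have h := hammingDist_pos.2 (hfne x).symm
        have h2 : hammingDist x (f x) ≤ Fintype.card (Fin 1) := hammingDist_le_card_fintype
        simp only [Fintype.card_fin] at h2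
        simp only [hypercubeGraph]
        omega
      refine ⟨f, hf, hadj, ?_⟩
      rintro S ⟨x, hx⟩ h1 -
      ext y
      simp only [Set.mem_univ, iff_true]
      by_cases hxy : y = x
      · rwa [hxy]
      · have h3 : f x = y := by
          funext j
          have h4 := hfne x
          obtain ⟨k, hk⟩ := Function.ne_iff.1 h4
          obtain ⟨l, hl⟩ := Function.ne_iff.1 hxy
          obtain rfl : k = j := Subsingleton.elim (α := Fin 1) k j
          obtain rfl : l = k := Subsingleton.elim (α := Fin 1) l k
          rw [Bool.eq_not.2 hk, Bool.eq_not.2 hl]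
        rw [← h3]; exact h1 hx
    · let e := splitIso i false
      obtain ⟨r, hr1, hr2, hr3⟩ := exists_completion_prism ih
        (by simp only [Fintype.card_pi, Fintype.card_bool, Finset.prod_const]
            exact (Nat.even_pow.2 ⟨even_two, by simp; omega⟩))
        (e ∘ f ∘ e.symm)
        (involutive_conj e.symm.toEquiv hf)
        (by intro x hx
            apply hfne (e.symm x)
            have := congrArg e.symm hx
            simpa using this)
        ⟨e default, by simpa [e, splitIso_fst] using hi⟩
      refine ⟨e.symm ∘ r ∘ e, involutive_conj e.toEquiv hr1, ?_, ?_⟩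
      · intro x
        have h1 : (prism (hypercubeGraph n)).Adj (e x) (e (e.symm (r (e x)))) := by
          rw [RelIso.apply_symm_apply]; exact hr2 _
        exact e.map_rel_iff.1 h1
      · have h1 := hr3.conj e.toEquiv
        have h2 : e.toEquiv.symm ∘ (e ∘ f ∘ e.symm) ∘ e.toEquiv = f := by
          funext x
          exact (e.symm_apply_apply _).trans (congrArg f (e.symm_apply_apply _))
        rw [h2] at h1
        exact h1
end Completion

/-! ### Hamiltonian cycles as pairs of matchings; merging two cycles -/

section Pairs
variable {W : Type*} {G : SimpleGraph W}

/-- Two perfect matchings of `G`, given by their partner maps, whose union is a Hamiltonian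
cycle. -/
structure HamPair (G : SimpleGraph W) (f r : W → W) : Prop where
  inv_left : Involutive f
  inv_right : Involutive r
  adj_left : ∀ x, G.Adj x (f x)
  adj_right : ∀ x, G.Adj x (r x)
  trans : JointlyTransitive f r

theorem HamPair.symm {f r : W → W} (h : HamPair G f r) : HamPair G r f :=
  ⟨h.2, h.1, h.4, h.3, h.5.symm⟩

/-- `xy` is an edge of one of the two matchings. -/
def EdgeOf (f r : W → W) (x y : W) : Prop := f x = y ∨ r x = y

theorem EdgeOf.swap {f r : W → W} {x y : W} (h : EdgeOf f r x y) : EdgeOf r f x y := Or.symm h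

theorem HamPair.edge_symm {f r : W → W} (h : HamPair G f r) {x y : W} (hxy : EdgeOf f r x y) :
    EdgeOf f r y x := by
  rcases hxy with h1 | h1
  · left; rw [← h1, h.inv_left]
  · right; rw [← h1, h.inv_right]

/-- The partner map of a matching, fixing the uncovered vertices. -/
structure IsPartial (G : SimpleGraph W) (m : W → W) : Prop where
  inv : Involutive m
  adj : ∀ x, m x ≠ x → G.Adj x (m x)

/-- The cycle given by `f` and `r` contains the matching `m`. -/
def ContainsMatching (f r m : W → W) : Prop := ∀ x, m x ≠ x → EdgeOf f r x (m x)

theorem ContainsMatching.swap {f r m : W → W} (h : ContainsMatching f r m) :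
    ContainsMatching r f m := fun x hx => (h x hx).swap

/-- A common edge of the two matchings would be a closed set of two vertices. -/
theorem HamPair.ne [Fintype W] {f r : W → W} (h : HamPair G f r) (hW : 2 < Fintype.card W)
    (x : W) : f x ≠ r x := by
  classical
  intro hx
  have h1 := h.trans {x, f x} ⟨x, by simp⟩
    (by rintro y (rfl | rfl)
        · simp
        · simp [h.inv_left x])
    (by rintro y (rfl | rfl)
        · simp [hx]
        · simp [hx, h.inv_right x])
  have h2 : (Finset.univ : Finset W) ⊆ {x, f x} := by
    intro y _
    have : y ∈ ({x, f x} : Set W) := by rw [h1]; trivial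
    simpa using this
  have h3 := Finset.card_le_card h2
  have h4 := Finset.card_le_two (a := x) (b := f x)
  rw [Finset.card_univ] at h3
  omega

variable [DecidableEq W]

/-- Cutting the edge `vy` leaves a connected path: `v` and `y` are then the only points fixed by the
second involution, so by parity an orbit containing one contains the other. -/
theorem HamPair.mem_of_closed_of_cut [Finite W] {f r : W → W} (h : HamPair G f r) {v y : W}
    (hv : r v = y) {S : Set W} (hS : S.Nonempty) (hf : Set.MapsTo f S S)
    (hr : ∀ x ∈ S, x ≠ v → x ≠ y → r x ∈ S) : S = Set.univ := by
  have hy : r y = v := by rw [← hv, h.inv_right]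
  let p : W → W := fun x => if x = v ∨ x = y then x else r x
  have hpi : Involutive p := by
    intro x
    have := h.inv_right x
    grind
  have hpS : Set.MapsTo p S S := by
    intro x hx
    have := hr x hx
    grind
  have hpx : ∀ x, p x = x ↔ x = v ∨ x = y := by
    intro x
    have := (h.adj_right x).ne
    grind
  have hpx' : ∀ x, p x = x ↔ x = y ∨ x = v := fun x => (hpx x).trans or_comm
  have hne : ∀ x, f x ≠ x := fun x => (h.adj_left x).ne'
  refine h.trans S hS hf ?_
  intro x hx
  by_cases h1 : x = v
  · subst h1
    rw [hv]
    exact mem_of_two_fixedPoints hpi h.inv_left hne hpx hpS hf hx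
  · by_cases h2 : x = y
    · subst h2
      rw [hy]
      exact mem_of_two_fixedPoints hpi h.inv_left hne hpx' hpS hf hx
    · exact hr x hx h1 h2

theorem HamPair.splice [Finite W] {f r f' r' : W → W} (h : HamPair G f r)
    (h' : HamPair G f' r') {v y : W} (hv : r v = y) (hv' : r' v = y) :
    HamPair (prism G) (fun p => (p.1, if p.1 then f' p.2 else f p.2))
      (fun p => if p.2 = v ∨ p.2 = y then (!p.1, p.2)
        else (p.1, if p.1 then r' p.2 else r p.2)) := by
  have hy : r y = v := by rw [← hv, h.inv_right]
  have hy' : r' y = v := by rw [← hv', h'.inv_right]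
  have hcut : ∀ x, x ≠ v → x ≠ y → r x ≠ v ∧ r x ≠ y := by
    intro x h1 h2
    have := h.inv_right x
    constructor <;> intro h3 <;> rw [h3] at this <;> grind
  have hcut' : ∀ x, x ≠ v → x ≠ y → r' x ≠ v ∧ r' x ≠ y := by
    intro x h1 h2
    have := h'.inv_right x
    constructor <;> intro h3 <;> rw [h3] at this <;> grind
  constructor
  · rintro ⟨b, x⟩
    cases b <;> simp [h.inv_left x, h'.inv_left x]
  · rintro ⟨b, x⟩
    by_cases hx : x = v ∨ x = y
    · simp [hx]
    · have h1 := hcut x (fun h => hx (Or.inl h)) (fun h => hx (Or.inr h))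
      have h2 := hcut' x (fun h => hx (Or.inl h)) (fun h => hx (Or.inr h))
      cases b <;> simp [hx, h1, h2, h.inv_right x, h'.inv_right x]
  · rintro ⟨b, x⟩
    left
    cases b
    · simpa using h.adj_left x
    · simpa using h'.adj_left x
  · rintro ⟨b, x⟩
    by_cases hx : x = v ∨ x = y
    · right; simp [hx]
    · left
      cases b
      · simpa [hx] using h.adj_right x
      · simpa [hx] using h'.adj_right x
  · intro S hS hF hR
    have hc0 : ∀ T : Set W, T = {x | (false, x) ∈ S} → T.Nonempty → T = Set.univ := by
      intro T hT hne
      refine h.mem_of_closed_of_cut hv hne ?_ ?_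
      · intro x hx
        rw [hT] at hx ⊢
        simpa using hF hx
      · intro x hx h1 h2
        rw [hT] at hx ⊢
        simpa [h1, h2] using hR hx
    have hc1 : ∀ T : Set W, T = {x | (true, x) ∈ S} → T.Nonempty → T = Set.univ := by
      intro T hT hne
      refine h'.mem_of_closed_of_cut hv' hne ?_ ?_
      · intro x hx
        rw [hT] at hx ⊢
        simpa using hF hx
      · intro x hx h1 h2
        rw [hT] at hx ⊢
        simpa [h1, h2] using hR hx
    have hswap : ∀ b, (b, v) ∈ S → (!b, v) ∈ S := by
      intro b hb
      simpa using hR hb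
    have hb : ∀ b x, (b, x) ∈ S → (b, v) ∈ S := by
      intro b x hx
      cases b
      · have : v ∈ {x | (false, x) ∈ S} := by rw [hc0 _ rfl ⟨x, hx⟩]; trivial
        exact this
      · have : v ∈ {x | (true, x) ∈ S} := by rw [hc1 _ rfl ⟨x, hx⟩]; trivial
        exact this
    obtain ⟨⟨b, x⟩, hx⟩ := hS
    have h1 := hb b x hx
    have h2 := hswap b h1
    have h3 : ∀ c, (c, v) ∈ S := by
      intro c
      cases b <;> cases c <;> assumption
    ext ⟨c, z⟩
    simp only [Set.mem_univ, iff_true]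
    cases c
    · have : z ∈ {x | (false, x) ∈ S} := by rw [hc0 _ rfl ⟨v, h3 _⟩]; trivial
      exact this
    · have : z ∈ {x | (true, x) ∈ S} := by rw [hc1 _ rfl ⟨v, h3 _⟩]; trivial
      exact this

/-- Two Hamiltonian cycles sharing the edge `vy` merge into one of the prism that replaces the two
copies of `vy` by vertical edges. -/
theorem HamPair.exists_merge [Finite W] {f r f' r' : W → W} (h : HamPair G f r)
    (h' : HamPair G f' r') {v y : W} (hv : EdgeOf f r v y) (hv' : EdgeOf f' r' v y) :
    ∃ F R, HamPair (prism G) F R ∧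
      (∀ x z, EdgeOf f r x z → ¬ (x = v ∧ z = y) → ¬ (x = y ∧ z = v) →
        EdgeOf F R (false, x) (false, z)) ∧
      (∀ x z, EdgeOf f' r' x z → ¬ (x = v ∧ z = y) → ¬ (x = y ∧ z = v) →
        EdgeOf F R (true, x) (true, z)) ∧
      ∀ b, EdgeOf F R (b, v) (!b, v) := by
  wlog hr : r v = y generalizing f r
  · have h1 : f v = y := hv.resolve_right hr
    obtain ⟨F, R, h2, h3, h4⟩ := this h.symm hv.swap h1
    exact ⟨F, R, h2, fun x z hxz => h3 x z hxz.swap, h4⟩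
  wlog hr' : r' v = y generalizing f' r'
  · have h1 : f' v = y := hv'.resolve_right hr'
    obtain ⟨F, R, h2, h3, h4, h5⟩ := this h'.symm hv'.swap h1
    exact ⟨F, R, h2, h3, fun x z hxz => h4 x z hxz.swap, h5⟩
  have hy : r y = v := by rw [← hr, h.inv_right]
  have hy' : r' y = v := by rw [← hr', h'.inv_right]
  refine ⟨_, _, h.splice h' hr hr', ?_, ?_, ?_⟩
  · rintro x z (hxz | hxz) h1 h2
    · left; simp [hxz]
    · right
      have : ¬ (x = v ∨ x = y) := by rintro (rfl | rfl) <;> grind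
      simp [this, hxz]
  · rintro x z (hxz | hxz) h1 h2
    · left; simp [hxz]
    · right
      have : ¬ (x = v ∨ x = y) := by rintro (rfl | rfl) <;> grind
      simp [this, hxz]
  · intro b; right; simp

/-- A spanning system of paths in the first copy (the orbits of `p` and `q`, with ends the fixed
points of `p`) and a matching of the second copy missing the same vertices extend together to a
Hamiltonian cycle of the prism. -/
theorem exists_hamPair_of_halves [Finite W] (hG : Completable G) {p q h : W → W}
    (hq : Involutive q) (hqadj : ∀ x, G.Adj x (q x)) (hp : IsPartial G p) (hh : IsPartial G h)
    (hfix : ∀ x, h x = x ↔ p x = x)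
    (hhit : ∀ S : Set W, S.Nonempty → Set.MapsTo p S S → Set.MapsTo q S S → ∃ x ∈ S, p x = x) :
    ∃ F R, HamPair (prism G) F R ∧ (∀ x, R (false, x) = (false, q x)) ∧
      (∀ x, p x ≠ x → F (false, x) = (false, p x)) ∧
      (∀ x, h x ≠ x → F (true, x) = (true, h x)) := by
  let g : Bool → W → W := fun b => if b then h else p
  have hgp : ∀ b, IsPartial G (g b) := by intro b; cases b <;> simpa [g]
  have hgfix : ∀ b c x, g b x = x → g c x = x := by
    intro b c x
    have := hfix x
    cases b <;> cases c <;> simp [g, this]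
  -- Both partial matchings miss the same vertices, so vertical edges there complete them to a
  -- perfect matching of the prism.
  let F : Bool × W → Bool × W := fun x =>
    if g x.1 x.2 = x.2 then (!x.1, x.2) else (x.1, g x.1 x.2)
  have hF1 : ∀ b x, g b x = x → F (b, x) = (!b, x) := by
    intro b x hx; simp [F, hx]
  have hF2 : ∀ b x, g b x ≠ x → F (b, x) = (b, g b x) := by
    intro b x hx; simp [F, hx]
  have hFi : Involutive F := by
    rintro ⟨b, x⟩
    by_cases hx : g b x = x
    · rw [hF1 b x hx, hF1 _ x (hgfix b _ x hx)]; simp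
    · have h1 : g b (g b x) ≠ g b x := by rw [(hgp b).inv x]; exact Ne.symm hx
      rw [hF2 b x hx, hF2 _ _ h1, (hgp b).inv x]
  have hFadj : ∀ x, (prism G).Adj x (F x) := by
    rintro ⟨b, x⟩
    by_cases hx : g b x = x
    · rw [hF1 b x hx]; right; simp
    · rw [hF2 b x hx]; left; exact ⟨rfl, (hgp b).adj x hx⟩
  have hhalf : half F false = p := by
    funext x
    unfold half
    by_cases hx : p x = x
    · rw [hF1 false x (by simpa [g] using hx)]; simp [hx]
    · rw [hF2 false x (by simpa [g] using hx)]; simp [g]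
  obtain ⟨r, hr1, hr2, hr3⟩ := exists_completion_of_half hG F hFi (fun x => (hFadj x).ne') q hq
    (fun x => (hqadj x).ne') (by
      rw [hhalf]
      intro S h1 h2 h3
      obtain ⟨x, hx, hpx⟩ := hhit S h1 h2 h3
      exact ⟨x, hx, by rw [hF1 false x (by simpa [g] using hpx)]; rfl⟩)
  refine ⟨F, _, ⟨hFi, ?_, hFadj, ?_, hr3⟩, ?_, ?_, ?_⟩
  · rintro ⟨b, x⟩
    cases b <;> simp [hq x, hr1 x]
  · rintro ⟨b, x⟩
    left
    cases b
    · simpa using hqadj x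
    · simpa using hr2 x
  · intro x; simp
  · intro x hx
    rw [hF2 false x (by simpa [g] using hx)]; simp [g]
  · intro x hx
    rw [hF2 true x (by simpa [g] using hx)]; simp [g]

end Pairs

/-! ### Rotating a Hamiltonian cycle at a chord -/

section Rotation
variable {W : Type*} {G : SimpleGraph W} [Fintype W]

/-- The cycle of a pair of matchings of a bipartite graph, as a permutation. -/
def HamPair.perm {f r : W → W} (h : HamPair G f r) {col : W → Bool}
    (hcol : ∀ x y, G.Adj x y → col x ≠ col y) : Equiv.Perm W where
  toFun x := if col x then f x else r x
  invFun x := if col x then r x else f x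
  left_inv x := by
    have h1 := hcol _ _ (h.adj_left x)
    have h2 := hcol _ _ (h.adj_right x)
    have h3 := h.inv_left x
    have h4 := h.inv_right x
    cases hx : col x <;> simp_all
  right_inv x := by
    have h1 := hcol _ _ (h.adj_left x)
    have h2 := hcol _ _ (h.adj_right x)
    have h3 := h.inv_left x
    have h4 := h.inv_right x
    cases hx : col x <;> simp_all

theorem mapsTo_perm_symm {S : Set W} {s : Equiv.Perm W} (h : Set.MapsTo s S S) :
    Set.MapsTo s.symm S S := by
  have h1 : s '' S = S := Set.eq_of_subset_of_ncard_le h.image_subset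
    (Set.ncard_image_of_injective S s.injective).ge
  intro x hx
  rw [← h1] at hx
  obtain ⟨y, hy, rfl⟩ := hx
  simpa using hy

theorem HamPair.perm_transitive {f r : W → W} (h : HamPair G f r) {col : W → Bool}
    (hcol : ∀ x y, G.Adj x y → col x ≠ col y) {S : Set W} (hS : S.Nonempty)
    (hm : Set.MapsTo (h.perm hcol) S S) : S = Set.univ := by
  have hm' := mapsTo_perm_symm hm
  refine h.trans S hS ?_ ?_
  · intro x hx
    cases hc : col x
    · simpa [HamPair.perm, hc] using hm' hx
    · simpa [HamPair.perm, hc] using hm hx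
  · intro x hx
    cases hc : col x
    · simpa [HamPair.perm, hc] using hm hx
    · simpa [HamPair.perm, hc] using hm' hx

variable [DecidableEq W]

/-- Multiplying a full cycle by a transposition separates the two points. -/
theorem not_sameCycle_mul_swap (s : Equiv.Perm W)
    (hs : ∀ S : Set W, S.Nonempty → Set.MapsTo s S S → S = Set.univ) {u v : W}
    (huv : u ≠ v) :
    ¬ (s * Equiv.swap u v).SameCycle v u := by
  intro hsc
  set t := s * Equiv.swap u v with ht
  have hall : ∀ x, t.SameCycle v x := by
    have : {x | t.SameCycle v x} = Set.univ := by
      refine hs _ ⟨v, Equiv.Perm.SameCycle.refl _ _⟩ ?_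
      intro x hx
      rw [Set.mem_ofPred_eq] at hx ⊢
      by_cases hxu : x = u
      · have : s x = t v := by rw [hxu]; simp [ht]
        rw [this]
        exact Equiv.Perm.sameCycle_apply_right.2 (Equiv.Perm.SameCycle.refl _ _)
      · by_cases hxv : x = v
        · have : s x = t u := by rw [hxv]; simp [ht]
          rw [this]
          exact Equiv.Perm.sameCycle_apply_right.2 hsc
        · have : s x = t x := by simp [ht, Equiv.swap_apply_of_ne_of_ne hxu hxv]
          rw [this]
          exact Equiv.Perm.sameCycle_apply_right.2 hx
    intro x
    have h : x ∈ {x | t.SameCycle v x} := by rw [this]; trivial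
    exact h
  have hsall : ∀ x y, s.SameCycle x y := by
    intro x
    have : {y | s.SameCycle x y} = Set.univ :=
      hs _ ⟨x, Equiv.Perm.SameCycle.refl _ _⟩
        (fun y hy => Equiv.Perm.sameCycle_apply_right.2 hy)
    intro y
    have h : y ∈ {y | s.SameCycle x y} := by rw [this]; trivial
    exact h
  have hfix : ∀ (g : Equiv.Perm W), (∀ x y, g.SameCycle x y) → ∀ x, g x ≠ x := by
    intro g hg x hx
    have h3 : ∀ y, y = x := by
      intro y
      obtain ⟨k, hk⟩ := hg x y
      rw [← hk]
      exact Equiv.Perm.zpow_apply_eq_self_of_apply_eq_self hx k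
    exact huv ((h3 u).trans (h3 v).symm)
  -- A permutation with a single orbit has a sign depending only on the number of points. If `t`
  -- also had a single orbit, `s` and `t` would have equal signs while differing by a transposition.
  have hsign : ∀ (g : Equiv.Perm W), (∀ x y, g.SameCycle x y) →
      Equiv.Perm.sign g = -(-1) ^ Fintype.card W := by
    intro g hg
    have hc : g.IsCycle := ⟨u, hfix g hg u, fun y _ => hg u y⟩
    rw [hc.sign]
    congr 2
    have : g.support = Finset.univ := by
      ext x; simp [hfix g hg x]
    rw [this, Finset.card_univ]
  have e1 := hsign s hsall
  have e2 := hsign t (fun x y => (hall x).symm.trans (hall y))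
  rw [ht, Equiv.Perm.sign_mul, Equiv.Perm.sign_swap huv, e1] at e2
  rcases Int.units_eq_one_or (-(-1) ^ Fintype.card W : ℤˣ) with h | h <;> rw [h] at e2 <;>
    exact absurd e2 (by decide)

/-- Exchanging two edges of a Hamiltonian cycle at the ends of a chord `uv` for that chord gives a
Hamiltonian path, the orbits of `p` and `q`, from `f u` to `r v`. -/
theorem HamPair.exists_rotation {f r : W → W} (h : HamPair G f r) {col : W → Bool}
    (hcol : ∀ x y, G.Adj x y → col x ≠ col y) {u v : W} (huv : G.Adj u v) (h1 : f u ≠ v)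
    (h2 : r u ≠ v) :
    ∃ p q : W → W, Involutive q ∧ (∀ x, G.Adj x (q x)) ∧ IsPartial G p ∧
      (∀ x, p x = x ↔ x = f u ∨ x = r v) ∧
      (∀ S : Set W, S.Nonempty → Set.MapsTo p S S → Set.MapsTo q S S → ∃ x ∈ S, p x = x) ∧
      q u = v ∧ (∀ x, x ≠ u → x ≠ f u → EdgeOf p q x (f x)) ∧
      (∀ x, x ≠ v → x ≠ r v → EdgeOf p q x (r x)) := by
  classical
  wlog hcu : col u = true generalizing col
  · exact this (col := fun x => !col x) (fun x y hxy => by simpa using hcol x y hxy)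
      (by simpa using hcu)
  have hcv : col v = false := by
    have := hcol _ _ huv
    rw [hcu] at this
    simpa using this.symm
  have hcf : ∀ x, col (f x) = !col x := fun x => Bool.eq_not.2 (hcol _ _ (h.adj_left x)).symm
  have hcr : ∀ x, col (r x) = !col x := fun x => Bool.eq_not.2 (hcol _ _ (h.adj_right x)).symm
  have ff := h.inv_left
  have rr := h.inv_right
  have ff' : ∀ x, f (f x) = x := ff
  have rr' : ∀ x, r (r x) = x := rr
  have fne : ∀ x, f x ≠ x := fun x => (h.adj_left x).ne'
  have rne : ∀ x, r x ≠ x := fun x => (h.adj_right x).ne'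
  have huv' : u ≠ v := huv.ne
  have h3 : r v ≠ u := fun h4 => h2 (by rw [← h4, rr'])
  have h4 : f v ≠ u := fun h4 => h1 (by rw [← h4, ff'])
  set s := h.perm hcol with hs
  have hs1 : ∀ x, col x = true → s x = f x := fun x hx => by simp [hs, HamPair.perm, hx]
  have hs2 : ∀ x, col x = false → s x = r x := fun x hx => by simp [hs, HamPair.perm, hx]
  have hs3 : ∀ x, col x = true → s.symm x = r x := fun x hx => by simp [hs, HamPair.perm, hx]
  have hs4 : ∀ x, col x = false → s.symm x = f x := fun x hx => by simp [hs, HamPair.perm, hx]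
  have hsep := not_sameCycle_mul_swap s (fun S hS hm => h.perm_transitive hcol hS hm) huv'
  -- Here `s u = f u` and `s v = r v`, so `t` closes each of the two arcs left by deleting these
  -- edges: `A` runs from `f u` to `v`, its complement from `r v` to `u`.
  set t := s * Equiv.swap u v with ht
  let A : Set W := {x | t.SameCycle v x}
  have htu : t u = r v := by rw [← hs2 v hcv]; simp [ht]
  have htv : t v = f u := by rw [← hs1 u hcu]; simp [ht]
  have ht' : ∀ x, x ≠ u → x ≠ v → t x = s x := fun x hxu hxv => by
    simp [ht, Equiv.swap_apply_of_ne_of_ne hxu hxv]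
  have hAt : ∀ x, t x ∈ A ↔ x ∈ A := fun x => Equiv.Perm.sameCycle_apply_right
  have hvA : v ∈ A := Equiv.Perm.SameCycle.refl _ _
  have huA : u ∉ A := hsep
  have hfuA : f u ∈ A := by rw [← htv, hAt]; exact hvA
  have hrvA : r v ∉ A := by rw [← htu, hAt]; exact huA
  have hAf : ∀ x, x ≠ u → x ≠ f u → (f x ∈ A ↔ x ∈ A) := by
    intro x hx1 hx2
    cases hc : col x
    · have e1 : t (f x) = x := by
        rw [ht' _ (by intro e; apply hx2; rw [← e, ff']) (by intro e; have := hcf x; grind),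
          hs1 _ (by rw [hcf, hc]; rfl), ff']
      rw [← hAt (f x), e1]
    · have e1 : t x = f x := by
        rw [ht' _ hx1 (by intro e; grind), hs1 _ hc]
      rw [← e1, hAt]
  have hAr : ∀ x, x ≠ v → x ≠ r v → (r x ∈ A ↔ x ∈ A) := by
    intro x hx1 hx2
    cases hc : col x
    · have e1 : t x = r x := by
        rw [ht' _ (by intro e; grind) hx1, hs2 _ hc]
      rw [← e1, hAt]
    · have e1 : t (r x) = x := by
        rw [ht' _ (by intro e; have := hcr x; grind) (by intro e; apply hx2; rw [← e, rr']),
          hs2 _ (by rw [hcr, hc]; rfl), rr']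
      rw [← hAt (r x), e1]
  -- Along the path `f u … v u … r v` the edges must alternate between `q` and `p`. With `uv` in
  -- `q`, the remaining edges at `v` and at `u` are `f v` and `r u`, so the roles of `f` and `r` are
  -- exchanged outside `A`.
  let p : W → W := fun x => if x = f u ∨ x = r v then x else if x ∈ A then f x else r x
  let q : W → W := fun x => if x = u then v else if x = v then u else if x ∈ A then r x else f x
  have hpfix : ∀ x, p x = x ↔ x = f u ∨ x = r v := by
    intro x
    have := fne x
    have := rne x
    simp only [p]
    grind
  have hpA : ∀ x, x ∈ A → x ≠ f u → p x = f x ∧ f x ∈ A ∧ f x ≠ f u := by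
    intro x hx hxf
    have hxu : x ≠ u := fun e => huA (e ▸ hx)
    have hxr : x ≠ r v := fun e => hrvA (e ▸ hx)
    refine ⟨by simp [p, hx, hxf, hxr], (hAf x hxu hxf).2 hx, fun e => hxu (ff.injective e)⟩
  have hpB : ∀ x, x ∉ A → x ≠ r v → p x = r x ∧ r x ∉ A ∧ r x ≠ r v := by
    intro x hx hxr
    have hxv : x ≠ v := fun e => hx (e ▸ hvA)
    have hxf : x ≠ f u := fun e => hx (e ▸ hfuA)
    refine ⟨by simp [p, hx, hxf, hxr], fun e => hx ((hAr x hxv hxr).1 e),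
      fun e => hxv (rr.injective e)⟩
  have hqA : ∀ x, x ∈ A → x ≠ v → q x = r x ∧ r x ∈ A ∧ r x ≠ v := by
    intro x hx hxv
    have hxu : x ≠ u := fun e => huA (e ▸ hx)
    have hxr : x ≠ r v := fun e => hrvA (e ▸ hx)
    refine ⟨by simp [q, hx, hxu, hxv], (hAr x hxv hxr).2 hx, fun e => hxr (by rw [← e, rr'])⟩
  have hqB : ∀ x, x ∉ A → x ≠ u → q x = f x ∧ f x ∉ A ∧ f x ≠ u := by
    intro x hx hxu
    have hxv : x ≠ v := fun e => hx (e ▸ hvA)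
    have hxf : x ≠ f u := fun e => hx (e ▸ hfuA)
    refine ⟨by simp [q, hx, hxu, hxv], fun e => hx ((hAf x hxu hxf).1 e),
      fun e => hxf (by rw [← e, ff'])⟩
  have hqu : q u = v := by simp [q]
  have hqv : q v = u := by simp [q, huv'.symm]
  have hedge1 : ∀ x, x ≠ u → x ≠ f u → EdgeOf p q x (f x) := by
    intro x hxu hxf
    by_cases hx : x ∈ A
    · left; exact (hpA x hx hxf).1
    · right; exact (hqB x hx hxu).1
  have hedge2 : ∀ x, x ≠ v → x ≠ r v → EdgeOf p q x (r x) := by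
    intro x hxv hxr
    by_cases hx : x ∈ A
    · right; exact (hqA x hx hxv).1
    · left; exact (hpB x hx hxr).1
  refine ⟨p, q, ?_, ?_, ⟨?_, ?_⟩, hpfix, ?_, hqu, hedge1, hedge2⟩
  · intro x
    by_cases hxu : x = u
    · rw [hxu, hqu, hqv]
    by_cases hxv : x = v
    · rw [hxv, hqv, hqu]
    by_cases hx : x ∈ A
    · obtain ⟨e1, e2, e3⟩ := hqA x hx hxv
      rw [e1, (hqA _ e2 e3).1, rr']
    · obtain ⟨e1, e2, e3⟩ := hqB x hx hxu
      rw [e1, (hqB _ e2 e3).1, ff']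
  · intro x
    by_cases hxu : x = u
    · rw [hxu, hqu]; exact huv
    by_cases hxv : x = v
    · rw [hxv, hqv]; exact huv.symm
    by_cases hx : x ∈ A
    · rw [(hqA x hx hxv).1]; exact h.adj_right x
    · rw [(hqB x hx hxu).1]; exact h.adj_left x
  · intro x
    by_cases hxf : x = f u ∨ x = r v
    · rw [(hpfix x).2 hxf, (hpfix x).2 hxf]
    push Not at hxf
    by_cases hx : x ∈ A
    · obtain ⟨e1, e2, e3⟩ := hpA x hx hxf.1
      rw [e1, (hpA _ e2 e3).1, ff']
    · obtain ⟨e1, e2, e3⟩ := hpB x hx hxf.2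
      rw [e1, (hpB _ e2 e3).1, rr']
  · intro x hxx
    have hxf : ¬ (x = f u ∨ x = r v) := fun e => hxx ((hpfix x).2 e)
    push Not at hxf
    by_cases hx : x ∈ A
    · rw [(hpA x hx hxf.1).1]; exact h.adj_left x
    · rw [(hpB x hx hxf.2).1]; exact h.adj_right x
  · intro S hS hp hq
    by_contra! hcon
    have hfu : f u ∉ S := fun e => hcon _ e ((hpfix _).2 (Or.inl rfl))
    have hrv : r v ∉ S := fun e => hcon _ e ((hpfix _).2 (Or.inr rfl))
    have hpq : ∀ x y, x ∈ S → EdgeOf p q x y → y ∈ S := by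
      rintro x y hx (e | e)
      · rw [← e]; exact hp hx
      · rw [← e]; exact hq hx
    -- Going backwards along the cycle, the deleted edges would be used only from `f u` or `r v`,
    -- and neither is in `S`.
    have hm : Set.MapsTo s.symm S S := by
      intro x hx
      cases hc : col x
      · rw [hs4 x hc]
        exact hpq x _ hx (hedge1 x (by grind) (fun e => hfu (e ▸ hx)))
      · rw [hs3 x hc]
        exact hpq x _ hx (hedge2 x (by grind) (fun e => hrv (e ▸ hx)))
    have hm' : Set.MapsTo s S S := by simpa using mapsTo_perm_symm hm
    have := h.perm_transitive hcol hS hm'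
    exact hfu (by rw [this]; trivial)

end Rotation

/-! ### Transport along graph isomorphisms -/

section Transport
variable {V W : Type*} {G : SimpleGraph V} {H : SimpleGraph W}

theorem IsPartial.conj (e : G ≃g H) {m : W → W} (h : IsPartial H m) :
    IsPartial G (e.symm ∘ m ∘ e) := by
  refine ⟨involutive_conj e.toEquiv h.inv, fun x hx => ?_⟩
  have h1 : m (e x) ≠ e x := fun h1 => hx (by simp [h1])
  have h2 : H.Adj (e x) (e (e.symm (m (e x)))) := by
    rw [RelIso.apply_symm_apply]; exact h.adj _ h1
  exact e.map_rel_iff.1 h2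

theorem HamPair.conj (e : G ≃g H) {f r : W → W} (h : HamPair H f r) :
    HamPair G (e.symm ∘ f ∘ e) (e.symm ∘ r ∘ e) := by
  have hadj : ∀ g : W → W, (∀ x, H.Adj x (g x)) → ∀ x, G.Adj x ((e.symm ∘ g ∘ e) x) := by
    intro g hg x
    have h2 : H.Adj (e x) (e (e.symm (g (e x)))) := by
      rw [RelIso.apply_symm_apply]; exact hg _
    exact e.map_rel_iff.1 h2
  exact ⟨involutive_conj e.toEquiv h.inv_left, involutive_conj e.toEquiv h.inv_right,
    hadj f h.adj_left, hadj r h.adj_right, h.trans.conj e.toEquiv⟩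

theorem EdgeOf.conj (e : V ≃ W) {f r : W → W} {x y : V} (h : EdgeOf f r (e x) (e y)) :
    EdgeOf (e.symm ∘ f ∘ e) (e.symm ∘ r ∘ e) x y := by
  rcases h with h | h
  · left; simp [h]
  · right; simp [h]

end Transport

/-! ### Bipartition, and matchings missing two vertices -/

section Coloring
variable {W : Type*} {G : SimpleGraph W}

theorem exists_coloring (n : ℕ) :
    ∃ col : (Fin n → Bool) → Bool, ∀ x y, (hypercubeGraph n).Adj x y → col x ≠ col y := by
  induction n with
  | zero =>
    exact ⟨fun _ => false, fun x y h => absurd (Subsingleton.elim x y) h.ne⟩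
  | succ n ih =>
    obtain ⟨col, hcol⟩ := ih
    let e := splitIso (0 : Fin (n + 1)) false
    refine ⟨fun v => xor (e v).1 (col (e v).2), ?_⟩
    intro x y hxy
    rcases e.map_rel_iff.2 hxy with ⟨h1, h2⟩ | ⟨h1, h2⟩
    · have := hcol _ _ h2
      simpa [h1] using this
    · simpa [h2] using h1

/-- Fink's theorem applied to all edges of direction `0`. -/
theorem exists_hamPair (n : ℕ) : ∃ f r, HamPair (hypercubeGraph (n + 1)) f r := by
  let f : (Fin (n + 1) → Bool) → Fin (n + 1) → Bool := fun v => Function.update v 0 (!v 0)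
  have hf : Involutive f := by
    intro v; simp [f]
  have hfadj : ∀ v, (hypercubeGraph (n + 1)).Adj v (f v) := by
    intro v
    apply (splitIso (0 : Fin (n + 1)) false).map_rel_iff.1
    right
    constructor
    · simp [splitIso_fst, f]
    · funext i
      simp [splitIso, f]
  obtain ⟨r, h1, h2, h3⟩ := completable_hypercubeGraph (n + 1) f hf (fun x => (hfadj x).ne')
  exact ⟨f, r, hf, h1, hfadj, h2, h3⟩

/-- A bipartite graph with a Hamiltonian cycle stays connected after deleting a vertex. -/
theorem HamPair.exists_path_avoiding [DecidableEq W] [Fintype W] {f r : W → W} (h : HamPair G f r)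
    {col : W → Bool} (hcol : ∀ x y, G.Adj x y → col x ≠ col y) {u v w : W} (hu : u ≠ w)
    (hv : v ≠ w) : ∃ P : G.Walk u v, P.IsPath ∧ w ∉ P.support := by
  set s := h.perm hcol with hs
  have hadj : ∀ x, G.Adj (s.symm x) x := by
    intro x
    cases hx : col x
    · simpa [hs, HamPair.perm, hx] using (h.adj_left x).symm
    · simpa [hs, HamPair.perm, hx] using (h.adj_right x).symm
  -- The target is the predecessor of `w`: following the cycle backwards from `w`, every further
  -- vertex is joined to it without meeting `w` again.
  let S : Set W := {t | t = w ∨ ∃ P : G.Walk t (s.symm w), w ∉ P.support}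
  have hm : Set.MapsTo s.symm S S := by
    rintro x (rfl | ⟨P, hP⟩)
    · exact Or.inr ⟨SimpleGraph.Walk.nil, by simpa using (hadj x).ne'⟩
    · by_cases hx : s.symm x = w
      · exact Or.inl hx
      · exact Or.inr ⟨SimpleGraph.Walk.cons (hadj x) P, by simp [hP, Ne.symm hx]⟩
  have hm' : Set.MapsTo s S S := by simpa using mapsTo_perm_symm hm
  have hall := h.perm_transitive hcol ⟨w, Or.inl rfl⟩ hm'
  have key : ∀ t, t ≠ w → ∃ P : G.Walk t (s.symm w), w ∉ P.support := by
    intro t ht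
    have : t ∈ S := by rw [hall]; trivial
    exact this.resolve_left ht
  obtain ⟨P, hP⟩ := key u hu
  obtain ⟨Q, hQ⟩ := key v hv
  refine ⟨(P.append Q.reverse).bypass, SimpleGraph.Walk.bypass_isPath _, fun hw => ?_⟩
  have := SimpleGraph.Walk.support_bypass_subset_support _ hw
  rw [SimpleGraph.Walk.mem_support_append_iff] at this
  simp [hP, hQ] at this

/-- Zigzagging along a path of columns: a matching of the prism missing two prescribed vertices of
opposite colors and vertical off the path. -/
theorem exists_zigzag [DecidableEq W] {col : W → Bool} (hcol : ∀ x y, G.Adj x y → col x ≠ col y)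
    {a z : W} (P : G.Walk a z) (hP : P.IsPath) :
    ∀ b d : Bool, xor d (col z) ≠ xor b (col a) → ∃ h : Bool × W → Bool × W,
      IsPartial (prism G) h ∧ (∀ p, h p = p ↔ p = (b, a) ∨ p = (d, z)) ∧
      ∀ c x, x ∉ P.support → h (c, x) = (!c, x) := by
  induction P with
  | nil =>
    rename_i a
    intro b d hbd
    have hbd' : d = !b := by
      apply Bool.eq_not.2
      intro h; exact hbd (by rw [h])
    refine ⟨fun p => if p.2 = a then p else (!p.1, p.2), ⟨?_, ?_⟩, ?_, ?_⟩
    · rintro ⟨c, x⟩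
      by_cases hx : x = a <;> simp [hx]
    · rintro ⟨c, x⟩ hx
      by_cases hxa : x = a
      · simp [hxa] at hx
      · right; simp [hxa]
    · rintro ⟨c, x⟩
      by_cases hx : x = a
      · subst hx; subst hbd'
        cases b <;> cases c <;> simp
      · simp [hx]
    · intro c x hx
      have : x ≠ a := by simpa using hx
      simp [this]
  | cons hadj Q ih =>
    rename_i a a' z
    intro b d hbd
    rw [SimpleGraph.Walk.cons_isPath_iff] at hP
    have hc := Bool.eq_not.2 (hcol _ _ hadj)
    obtain ⟨h, h1, h2, h3⟩ := ih hP.1 (!b) d (by rw [hc] at hbd; simpa using hbd)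
    have hne : a' ≠ a := hadj.ne'
    have hza : z ≠ a := fun e => hP.2 (e ▸ Q.end_mem_support)
    have ha : ∀ c, h (c, a) = (!c, a) := fun c => h3 c a hP.2
    have ha' : h (!b, a') = (!b, a') := (h2 _).2 (Or.inl rfl)
    have hinv : ∀ p, h (h p) = p := h1.inv
    -- The matching of the shorter path misses `(!b, a')`. The vertical edge at column `a` is given
    -- up, and its end `(!b, a)` is joined to that vertex, so that `(b, a)` becomes the missing one.
    let g : Bool × W → Bool × W := fun p => if p = (b, a) then p else
      if p = (!b, a) then (!b, a') else if p = (!b, a') then (!b, a) else h p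
    have hg1 : g (b, a) = (b, a) := by simp [g]
    have hg2 : g (!b, a) = (!b, a') := by simp [g]
    have hg3 : g (!b, a') = (!b, a) := by simp [g, hne]
    have hg4 : ∀ p, p ≠ (b, a) → p ≠ (!b, a) → p ≠ (!b, a') → g p = h p := by
      intro p e1 e2 e3; simp [g, e1, e2, e3]
    have hcases : ∀ p, p = (b, a) ∨ p = (!b, a) ∨ p = (!b, a') ∨
        (p ≠ (b, a) ∧ p ≠ (!b, a) ∧ p ≠ (!b, a')) := by
      intro p; tauto
    have hout : ∀ p, p ≠ (b, a) → p ≠ (!b, a) → p ≠ (!b, a') →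
        h p ≠ (b, a) ∧ h p ≠ (!b, a) ∧ h p ≠ (!b, a') := by
      intro p e1 e2 e3
      refine ⟨fun e => ?_, fun e => ?_, fun e => ?_⟩
      · apply e2; rw [← hinv p, e, ha]
      · apply e1; rw [← hinv p, e, ha]; simp
      · apply e3; rw [← hinv p, e, ha']
    refine ⟨g, ⟨?_, ?_⟩, ?_, ?_⟩
    · intro p
      rcases hcases p with rfl | rfl | rfl | ⟨e1, e2, e3⟩
      · rw [hg1, hg1]
      · rw [hg2, hg3]
      · rw [hg3, hg2]
      · obtain ⟨o1, o2, o3⟩ := hout p e1 e2 e3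
        rw [hg4 p e1 e2 e3, hg4 _ o1 o2 o3, hinv]
    · intro p hp
      rcases hcases p with rfl | rfl | rfl | ⟨e1, e2, e3⟩
      · exact absurd hg1 hp
      · rw [hg2]; left; exact ⟨rfl, hadj⟩
      · rw [hg3]; left; exact ⟨rfl, hadj.symm⟩
      · rw [hg4 p e1 e2 e3] at hp ⊢
        exact h1.adj p hp
    · intro p
      rcases hcases p with rfl | rfl | rfl | ⟨e1, e2, e3⟩
      · simp [hg1]
      · rw [hg2]; simp [hne, Ne.symm hza]
      · rw [hg3]
        simp only [Prod.mk.injEq, hne, and_false, false_or, Ne.symm hne, false_iff]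
        rintro ⟨e1, e2⟩
        rw [← e2, ← e1, hc] at hbd
        simp at hbd
      · rw [hg4 p e1 e2 e3, h2]; simp [e1, e3]
    · intro c x hx
      simp only [SimpleGraph.Walk.support_cons, List.mem_cons, not_or] at hx
      have hxa' : x ≠ a' := fun e => hx.2 (e ▸ Q.start_mem_support)
      rw [hg4 _ (by simp [hx.1]) (by simp [hx.1]) (by simp [hxa'])]
      exact h3 c x hx.2

/-- Removing two vertices of opposite colors from the hypercube leaves a graph with a perfect
matching through any given edge. -/
theorem exists_matching_missing_two {n : ℕ} {col : (Fin n → Bool) → Bool}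
    (hcol : ∀ x y, (hypercubeGraph n).Adj x y → col x ≠ col y) {a b x y : Fin n → Bool}
    (hab : (hypercubeGraph n).Adj a b) (hxy : col x ≠ col y) (hxa : x ≠ a) (hxb : x ≠ b)
    (hya : y ≠ a) (hyb : y ≠ b) :
    ∃ h, IsPartial (hypercubeGraph n) h ∧ (∀ p, h p = p ↔ p = x ∨ p = y) ∧ h a = b := by
  obtain ⟨i, hi⟩ := Function.ne_iff.1 hab.ne
  rcases n with _ | n
  · exact i.elim0
  -- Splitting in the direction of `ab` makes that edge vertical. A path of columns from `x` to `y`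
  -- avoiding its column then gives a zigzag that leaves `ab` in place.
  let e := splitIso i false
  have hei : (e a).1 ≠ (e b).1 := by simpa [e, splitIso_fst] using hi
  have hab2 : (e a).2 = (e b).2 := by
    rcases e.map_rel_iff.2 hab with ⟨h1, h2⟩ | ⟨h1, h2⟩
    · exact absurd h1 hei
    · exact h2
  have hcolumn : ∀ z, z ≠ a → z ≠ b → (e z).2 ≠ (e a).2 := by
    intro z hza hzb hz
    by_cases h1 : (e z).1 = (e a).1
    · exact hza (e.injective (Prod.ext h1 hz))
    · refine hzb (e.injective (Prod.ext ?_ (hz.trans hab2)))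
      revert h1 hei
      cases (e z).1 <;> cases (e a).1 <;> cases (e b).1 <;> simp
  let col' : (Fin n → Bool) → Bool := fun z => col (e.symm (false, z))
  have hadj' : ∀ p q, (prism (hypercubeGraph n)).Adj p q → col (e.symm p) ≠ col (e.symm q) :=
    fun p q hpq => hcol _ _ (e.symm.map_rel_iff.2 hpq)
  have hcol' : ∀ u v, (hypercubeGraph n).Adj u v → col' u ≠ col' v :=
    fun u v huv => hadj' _ _ (Or.inl ⟨rfl, huv⟩)
  have hcc : ∀ p : Bool × (Fin n → Bool), col (e.symm p) = xor p.1 (col' p.2) := by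
    rintro ⟨c, z⟩
    cases c
    · simp [col']
    · have := hadj' (true, z) (false, z) (Or.inr ⟨by simp, rfl⟩)
      simpa [col'] using Bool.eq_not.2 this
  have hpath : ∃ P : (hypercubeGraph n).Walk (e x).2 (e y).2, P.IsPath ∧ (e a).2 ∉ P.support := by
    rcases n with _ | n
    · exact absurd (Subsingleton.elim _ _) (hcolumn x hxa hxb)
    · obtain ⟨f, r, hfr⟩ := exists_hamPair n
      exact hfr.exists_path_avoiding hcol' (hcolumn x hxa hxb) (hcolumn y hya hyb)
  obtain ⟨P, hP, haP⟩ := hpath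
  obtain ⟨h, h1, h2, h3⟩ := exists_zigzag hcol' P hP (e x).1 (e y).1 (by
    rw [← hcc, ← hcc]; simpa using hxy.symm)
  refine ⟨e.symm ∘ h ∘ e, h1.conj e, ?_, ?_⟩
  · intro p
    have e1 : (e.symm ∘ h ∘ e) p = p ↔ h (e p) = e p := by
      constructor
      · intro hp
        have := congrArg e hp
        simpa using this
      · intro hp
        simp [hp]
    rw [e1, h2]
    simp
  · have e1 : h (e a) = e b := by
      have := h3 (e a).1 (e a).2 haP
      rw [Prod.mk.eta] at this
      rw [this]
      refine Prod.ext (Bool.eq_not.2 hei.symm).symm hab2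
    simp [e1]

end Coloring

/-! ### Adding and removing a matching edge -/

section Edit
variable {W : Type*} [DecidableEq W] {G : SimpleGraph W}

/-- Adding the edge `ab` to a matching. -/
def addPair (m : W → W) (a b x : W) : W := if x = a then b else if x = b then a else m x

theorem IsPartial.addPair {m : W → W} (hm : IsPartial G m) {a b : W} (ha : m a = a) (hb : m b = b)
    (hab : G.Adj a b) : IsPartial G (addPair m a b) := by
  have hne := hab.ne
  have h1 : HypercubeMatching.addPair m a b a = b := by simp [HypercubeMatching.addPair]
  have h2 : HypercubeMatching.addPair m a b b = a := by simp [HypercubeMatching.addPair, hne.symm]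
  have h3 : ∀ x, x ≠ a → x ≠ b → HypercubeMatching.addPair m a b x = m x := by
    intro x e1 e2; simp [HypercubeMatching.addPair, e1, e2]
  constructor
  · intro x
    by_cases e1 : x = a
    · rw [e1, h1, h2]
    by_cases e2 : x = b
    · rw [e2, h2, h1]
    rw [h3 x e1 e2, h3, hm.inv x]
    · intro e; apply e1; rw [← hm.inv x, e, ha]
    · intro e; apply e2; rw [← hm.inv x, e, hb]
  · intro x hx
    by_cases e1 : x = a
    · rw [e1, h1]; exact hab
    by_cases e2 : x = b
    · rw [e2, h2]; exact hab.symm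
    rw [h3 x e1 e2] at hx ⊢
    exact hm.adj x hx

/-- Removing the edge at `a` from a matching. -/
def removePair (m : W → W) (a x : W) : W := if x = a ∨ x = m a then x else m x

theorem IsPartial.removePair {m : W → W} (hm : IsPartial G m) (a : W) :
    IsPartial G (removePair m a) := by
  have hi : ∀ x, m (m x) = x := hm.inv
  constructor
  · intro x
    unfold HypercubeMatching.removePair
    have := hi x
    have := hi a
    grind
  · intro x hx
    unfold HypercubeMatching.removePair at hx ⊢
    split_ifs at hx ⊢ with h
    · exact absurd rfl hx
    · exact hm.adj x hx

end Edit

/-! ### Counting covered vertices -/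

section Counting
variable {W : Type*} [Fintype W] [DecidableEq W] {G : SimpleGraph W}

/-- The number of vertices covered by a matching. -/
def movedCard (m : W → W) : ℕ := (Finset.univ.filter fun x => m x ≠ x).card

theorem even_movedCard {m : W → W} (hm : Involutive m) : Even (movedCard m) := by
  refine even_card_of_involutive _ m hm ?_ (fun x hx => (Finset.mem_filter.1 hx).2)
  intro x hx
  simp only [Finset.mem_filter, Finset.mem_univ, true_and] at hx ⊢
  rw [hm x]; exact hx.symm

theorem exists_fixed_ne {m : W → W} {T : Finset W} (h : movedCard m + T.card < Fintype.card W) :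
    ∃ v, v ∉ T ∧ m v = v := by
  by_contra! hcon
  have h1 : (Finset.univ : Finset W) ⊆ (Finset.univ.filter fun x => m x ≠ x) ∪ T := by
    intro x _
    by_cases hx : x ∈ T
    · simp [hx]
    · simp [hcon x hx]
  have h2 := Finset.card_le_card h1
  have h3 := Finset.card_union_le (Finset.univ.filter fun x => m x ≠ x) T
  rw [Finset.card_univ] at h2
  unfold movedCard at h
  omega

theorem movedCard_addPair_le (m : W → W) (a b : W) :
    movedCard (addPair m a b) ≤ movedCard m + 2 := by
  have h1 : (Finset.univ.filter fun x => addPair m a b x ≠ x) ⊆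
      (Finset.univ.filter fun x => m x ≠ x) ∪ {a, b} := by
    intro x hx
    simp only [Finset.mem_filter, Finset.mem_univ, true_and, Finset.mem_union, Finset.mem_insert,
      Finset.mem_singleton] at hx ⊢
    by_cases e1 : x = a
    · simp [e1]
    by_cases e2 : x = b
    · simp [e2]
    have : addPair m a b x = m x := by simp [addPair, e1, e2]
    rw [this] at hx
    exact Or.inl hx
  have h2 := Finset.card_le_card h1
  have h3 := Finset.card_union_le (Finset.univ.filter fun x => m x ≠ x) {a, b}
  have h4 := Finset.card_le_two (a := a) (b := b)
  unfold movedCard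
  omega

theorem movedCard_removePair {m : W → W} (hm : Involutive m) {a : W} (ha : m a ≠ a) :
    movedCard (removePair m a) + 2 ≤ movedCard m := by
  have h1 : (Finset.univ.filter fun x => removePair m a x ≠ x) =
      ((Finset.univ.filter fun x => m x ≠ x).erase a).erase (m a) := by
    ext x
    simp only [Finset.mem_filter, Finset.mem_univ, true_and, Finset.mem_erase]
    unfold removePair
    by_cases h : x = a ∨ x = m a
    · rw [if_pos h]; tauto
    · rw [if_neg h]; tauto
  have h2 : m (m a) ≠ m a := by rw [hm a]; exact ha.symm
  have h3 : 2 ≤ (Finset.univ.filter fun x => m x ≠ x).card := by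
    have : ({a, m a} : Finset W) ⊆ Finset.univ.filter fun x => m x ≠ x := by
      intro x hx
      simp only [Finset.mem_insert, Finset.mem_singleton] at hx
      rcases hx with rfl | rfl <;> simp [ha, h2]
    have := Finset.card_le_card this
    rwa [Finset.card_pair ha.symm] at this
  unfold movedCard
  rw [h1, Finset.card_erase_of_mem (by simp [ha, h2]), Finset.card_erase_of_mem (by simp [ha])]
  omega

theorem movedCard_two {m : W → W} (hm : Involutive m) (h : movedCard m ≤ 2) {a : W}
    (ha : m a ≠ a) {x : W} (hx : m x ≠ x) : x = a ∨ x = m a := by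
  have h1 := movedCard_removePair hm ha
  have h2 : movedCard (removePair m a) = 0 := by omega
  unfold movedCard at h2
  rw [Finset.card_eq_zero, Finset.filter_eq_empty_iff] at h2
  have h3 := h2 (Finset.mem_univ x)
  simp only [removePair, ne_eq, not_not] at h3
  by_contra hc
  rw [if_neg hc] at h3
  exact hx h3

theorem movedCard_eq_zero {m : W → W} (h : movedCard m = 0) (x : W) : m x = x := by
  unfold movedCard at h
  rw [Finset.card_eq_zero, Finset.filter_eq_empty_iff] at h
  simpa using h (Finset.mem_univ x)

theorem two_le_movedCard {m : W → W} (hm : Involutive m) {a : W} (ha : m a ≠ a) :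
    2 ≤ movedCard m := by
  have := movedCard_removePair hm ha
  omega

end Counting

/-! ### Matchings of a prism through their two halves -/

section Halves
variable {W : Type*} [DecidableEq W] {G : SimpleGraph W}

theorem IsPartial.prism_cases {m : Bool × W → Bool × W} (hm : IsPartial (prism G) m) (b : Bool)
    (x : W) : m (b, x) = (b, half m b x) ∨ (m (b, x) = (!b, x) ∧ half m b x = x) := by
  by_cases h : (m (b, x)).1 = b
  · left
    refine Prod.ext h ?_
    simp [half, h]
  · right
    have hne : m (b, x) ≠ (b, x) := fun e => h (by rw [e])
    refine ⟨?_, by simp [half, h]⟩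
    rcases hm.adj _ hne with ⟨h1, h2⟩ | ⟨h1, h2⟩
    · exact absurd h1.symm h
    · exact Prod.ext (Bool.eq_not.2 h) h2.symm

theorem IsPartial.half {m : Bool × W → Bool × W} (hm : IsPartial (prism G) m) (b : Bool) :
    IsPartial G (half m b) := by
  refine ⟨half_involutive hm.inv b, fun x hx => ?_⟩
  rcases hm.prism_cases b x with h | h
  · have hne : m (b, x) ≠ (b, x) := by
      rw [h]; simpa using hx
    have := hm.adj _ hne
    rw [h] at this
    rcases this with h | h
    · exact h.2
    · exact absurd rfl h.1
  · exact absurd h.2 hx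

/-- The number of vertices whose matching edge joins the two copies. -/
def crossCard [Fintype W] (m : Bool × W → Bool × W) : ℕ :=
  (Finset.univ.filter fun p => (m p).1 ≠ p.1).card

theorem IsPartial.movedCard_eq [Fintype W] {m : Bool × W → Bool × W}
    (hm : IsPartial (prism G) m) :
    movedCard m = movedCard (HypercubeMatching.half m false) +
      movedCard (HypercubeMatching.half m true) + crossCard m := by
  have key : ∀ b x, (if m (b, x) ≠ (b, x) then 1 else 0 : ℕ) =
      (if HypercubeMatching.half m b x ≠ x then 1 else 0) +
      (if (m (b, x)).1 ≠ b then 1 else 0) := by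
    intro b x
    rcases hm.prism_cases b x with h | ⟨h, h'⟩
    · rw [h]; simp
    · rw [h, h']; simp
  unfold movedCard crossCard
  simp only [Finset.card_filter]
  rw [Fintype.sum_prod_type, Fintype.sum_prod_type]
  simp only [Fintype.sum_bool, key, Finset.sum_add_distrib]
  omega

theorem crossCard_pair {W : Type*} {G : SimpleGraph W} [Fintype W] {m : Bool × W → Bool × W} (hm : IsPartial (prism G) m)
    {b : Bool} {x : W} (h : m (b, x) = (!b, x)) (c : Bool) : m (c, x) = (!c, x) := by
  by_cases hc : c = b
  · rw [hc, h]
  · rw [Bool.eq_not.2 hc, ← h, hm.inv]; simp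

theorem two_le_crossCard [Fintype W] {m : Bool × W → Bool × W} (hm : IsPartial (prism G) m)
    {b : Bool} {x : W} (h : m (b, x) = (!b, x)) : 2 ≤ crossCard m := by
  have hs : ({(false, x), (true, x)} : Finset (Bool × W)) ⊆
      Finset.univ.filter fun p => (m p).1 ≠ p.1 := by
    intro p hp
    simp only [Finset.mem_insert, Finset.mem_singleton] at hp
    rcases hp with rfl | rfl <;> simp [crossCard_pair hm h]
  have := Finset.card_le_card hs
  rwa [Finset.card_pair (by simp)] at this

theorem crossCard_unique [Fintype W] {m : Bool × W → Bool × W} (hm : IsPartial (prism G) m)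
    (hc : crossCard m ≤ 3) {b c : Bool} {x y : W} (hx : m (b, x) = (!b, x))
    (hy : m (c, y) = (!c, y)) : x = y := by
  by_contra hxy
  have hs : ({(false, x), (true, x), (false, y), (true, y)} : Finset (Bool × W)) ⊆
      Finset.univ.filter fun p => (m p).1 ≠ p.1 := by
    intro p hp
    simp only [Finset.mem_insert, Finset.mem_singleton] at hp
    rcases hp with rfl | rfl | rfl | rfl <;> simp [crossCard_pair hm hx, crossCard_pair hm hy]
  have h := Finset.card_le_card hs
  rw [Finset.card_insert_of_notMem (by simp [hxy]), Finset.card_insert_of_notMem (by simp [hxy]),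
    Finset.card_pair (by simp)] at h
  unfold crossCard at hc
  omega

/-- Merging Hamiltonian cycles through the two halves of a matching. -/
theorem merge_containing [Finite W] {m : Bool × W → Bool × W} (hm : IsPartial (prism G) m)
    {f r f' r' : W → W} (h : HamPair G f r) (h' : HamPair G f' r')
    (hc : ContainsMatching f r (half m false)) (hc' : ContainsMatching f' r' (half m true))
    {v y : W} (hv : EdgeOf f r v y) (hv' : EdgeOf f' r' v y) (hne : half m false v ≠ y)
    (hne' : half m true v ≠ y) (hcross : ∀ b x, m (b, x) = (!b, x) → x = v) :
    ∃ F R, HamPair (prism G) F R ∧ ContainsMatching F R m ∧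
      (∀ x z, EdgeOf f r x z → ¬ (x = v ∧ z = y) → ¬ (x = y ∧ z = v) →
        EdgeOf F R (false, x) (false, z)) ∧ ∀ b, EdgeOf F R (b, v) (!b, v) := by
  obtain ⟨F, R, h1, h2, h3, h4⟩ := h.exists_merge h' hv hv'
  refine ⟨F, R, h1, ?_, h2, h4⟩
  have hpair : ∀ b x, half m b v ≠ y → ¬ (x = v ∧ half m b x = y) ∧ ¬ (x = y ∧ half m b x = v) := by
    intro b x hb
    refine ⟨fun e => hb (e.1 ▸ e.2), fun e => hb ?_⟩
    rw [← e.2, e.1, half_involutive hm.inv b]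
  rintro ⟨b, x⟩ hx
  rcases hm.prism_cases b x with e | ⟨e, -⟩
  · rw [e] at hx ⊢
    have hx' : half m b x ≠ x := by simpa using hx
    cases b
    · exact h2 _ _ (hc x hx') (hpair _ x hne).1 (hpair _ x hne).2
    · exact h3 _ _ (hc' x hx') (hpair _ x hne').1 (hpair _ x hne').2
  · rw [e, hcross b x e]; exact h4 b

/-- A matching of the prism whose two halves embed in one matching of the base extends. -/
theorem extends_of_copies {m : Bool × W → Bool × W} (hG : Completable (prism G))
    (hm : IsPartial (prism G) m) {g : W → W} (hg : IsPartial G g)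
    (h1 : ∀ b x, half m b x ≠ x → g x = half m b x)
    (h2 : ∀ b x, m (b, x) = (!b, x) → g x = x) :
    ∃ F R, HamPair (prism G) F R ∧ ContainsMatching F R m := by
  -- Two copies of `g` with vertical edges over its fixed points: a perfect matching of the prism
  -- containing `m`.
  let F : Bool × W → Bool × W := fun x => if g x.2 = x.2 then (!x.1, x.2) else (x.1, g x.2)
  have hF1 : ∀ b x, g x = x → F (b, x) = (!b, x) := by
    intro b x hx; simp [F, hx]
  have hF2 : ∀ b x, g x ≠ x → F (b, x) = (b, g x) := by
    intro b x hx; simp [F, hx]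
  have hFi : Involutive F := by
    rintro ⟨b, x⟩
    by_cases hx : g x = x
    · rw [hF1 b x hx, hF1 _ x hx]; simp
    · have h1 : g (g x) ≠ g x := by rw [hg.inv x]; exact Ne.symm hx
      rw [hF2 b x hx, hF2 _ _ h1, hg.inv x]
  have hFadj : ∀ x, (prism G).Adj x (F x) := by
    rintro ⟨b, x⟩
    by_cases hx : g x = x
    · rw [hF1 b x hx]; right; simp
    · rw [hF2 b x hx]; left; exact ⟨rfl, hg.adj x hx⟩
  obtain ⟨R, hR1, hR2, hR3⟩ := hG F hFi (fun x => (hFadj x).ne')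
  refine ⟨F, R, ⟨hFi, hR1, hFadj, hR2, hR3⟩, ?_⟩
  rintro ⟨b, x⟩ hx
  left
  rcases hm.prism_cases b x with e | ⟨e, -⟩
  · rw [e] at hx ⊢
    have hx' : half m b x ≠ x := by simpa using hx
    have := h1 b x hx'
    rw [hF2 b x (by rw [this]; exact hx'), this]
  · rw [e, hF1 b x (h2 b x e)]

/-- Rotating a Hamiltonian cycle of the first copy at a chord `uv` and closing up through the
second copy along a matching missing the two ends. -/
theorem exists_hamPair_rotation [Fintype W] (hG : Completable G) {f r : W → W}
    (h : HamPair G f r) {col : W → Bool} (hcol : ∀ x y, G.Adj x y → col x ≠ col y) {u v : W}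
    (huv : G.Adj u v) (he : ¬ EdgeOf f r u v) {g : W → W} (hg : IsPartial G g)
    (hgfix : ∀ x, g x = x ↔ x = f u ∨ x = r v) :
    ∃ F R, HamPair (prism G) F R ∧ EdgeOf F R (false, u) (false, v) ∧
      (∀ x z, EdgeOf f r x z → ¬ (x = u ∧ z = f u) → ¬ (x = f u ∧ z = u) →
        ¬ (x = v ∧ z = r v) → ¬ (x = r v ∧ z = v) → EdgeOf F R (false, x) (false, z)) ∧
      ∀ x, g x ≠ x → EdgeOf F R (true, x) (true, g x) := by
  obtain ⟨p, q, hq, hqadj, hp, hpfix, hhit, hquv, h1, h2⟩ := h.exists_rotation hcol huv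
    (fun e => he (Or.inl e)) (fun e => he (Or.inr e))
  obtain ⟨F, R, hFR, h3, h4, h5⟩ := exists_hamPair_of_halves hG hq hqadj hp hg
    (fun x => (hgfix x).trans (hpfix x).symm) hhit
  have key : ∀ x z, x ≠ z → EdgeOf p q x z → EdgeOf F R (false, x) (false, z) := by
    rintro x z hxz (e | e)
    · left
      rw [h4 x (by rw [e]; exact hxz.symm), e]
    · right
      rw [h3, e]
  refine ⟨F, R, hFR, Or.inr (by rw [h3, hquv]), ?_, fun x hx => Or.inl (h5 x hx)⟩
  rintro x z (rfl | rfl) e1 e2 e3 e4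
  · refine key _ _ (h.adj_left x).ne (h1 x (fun e => e1 ⟨e, by rw [e]⟩) (fun e => e2 ⟨e, ?_⟩))
    rw [e, h.inv_left]
  · refine key _ _ (h.adj_right x).ne (h2 x (fun e => e3 ⟨e, by rw [e]⟩) (fun e => e4 ⟨e, ?_⟩))
    rw [e, h.inv_right]

end Halves

/-! ### Induction step for matchings -/

section Steps

/-- Matchings covering at most `k` vertices extend to Hamiltonian cycles. -/
def ExtendsMatchings {W : Type*} [Fintype W] [DecidableEq W] (G : SimpleGraph W) (k : ℕ) : Prop :=
  ∀ m : W → W, IsPartial G m → movedCard m ≤ k →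
    ∃ f r, HamPair G f r ∧ ContainsMatching f r m

/-- Matchings covering at most `k` vertices extend to Hamiltonian cycles together with one
further edge having an uncovered end. -/
def ExtendsWithEdge {W : Type*} [Fintype W] [DecidableEq W] (G : SimpleGraph W) (k : ℕ) : Prop :=
  ∀ (m : W → W) (w y : W), IsPartial G m → movedCard m ≤ k → m w = w → G.Adj w y →
    ∃ f r, HamPair G f r ∧ ContainsMatching f r m ∧ EdgeOf f r w y

theorem completable_prism (n : ℕ) : Completable (prism (hypercubeGraph n)) := by
  intro f hf hfne
  let e := (splitIso (0 : Fin (n + 1)) false).symm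
  obtain ⟨r, h1, h2, h3⟩ := completable_hypercubeGraph (n + 1) (e ∘ f ∘ e.symm)
    (involutive_conj e.symm.toEquiv hf)
    (by intro x hx
        apply hfne (e.symm x)
        have := congrArg e.symm hx
        simpa using this)
  refine ⟨e.symm ∘ r ∘ e, involutive_conj e.toEquiv h1, ?_, ?_⟩
  · intro x
    have h4 : (hypercubeGraph (n + 1)).Adj (e x) (e (e.symm (r (e x)))) := by
      rw [RelIso.apply_symm_apply]; exact h2 _
    exact e.map_rel_iff.1 h4
  · have h4 := h3.conj e.toEquiv
    have h5 : e.toEquiv.symm ∘ (e ∘ f ∘ e.symm) ∘ e.toEquiv = f := by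
      funext x
      exact (e.symm_apply_apply _).trans (congrArg f (e.symm_apply_apply _))
    rw [h5] at h4
    exact h4

theorem card_cube (n : ℕ) : Fintype.card (Fin n → Bool) = 2 ^ n := by simp

theorem two_mul_add_two_le_two_pow {n : ℕ} (hn : 3 ≤ n) : 2 * n + 2 ≤ 2 ^ n := by
  induction n, hn using Nat.le_induction with
  | base => norm_num
  | succ n hn ih => rw [pow_succ]; omega

variable {n : ℕ}

theorem two_lt_card_cube (hn : 2 ≤ n) : 2 < Fintype.card (Fin n → Bool) := by
  rw [card_cube]
  calc 2 < 2 ^ 2 := by norm_num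
    _ ≤ 2 ^ n := Nat.pow_le_pow_right (by norm_num) hn

theorem HamPair.edgeOf_adj {W : Type*} {G : SimpleGraph W} {f r : W → W} (h : HamPair G f r)
    {x y : W} (hxy : EdgeOf f r x y) : G.Adj x y := by
  rcases hxy with e | e
  · rw [← e]; exact h.adj_left x
  · rw [← e]; exact h.adj_right x

theorem HamPair.exists_edge_ne {W : Type*} [Fintype W] {G : SimpleGraph W} {f r : W → W}
    (h : HamPair G f r) (hW : 2 < Fintype.card W) (v z : W) : ∃ y, EdgeOf f r v y ∧ y ≠ z := by
  by_cases hz : f v = z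
  · exact ⟨r v, Or.inr rfl, fun e => h.ne hW v (hz.trans e.symm)⟩
  · exact ⟨f v, Or.inl rfl, hz⟩

/-- A Hamiltonian cycle through one half of a matching extends to the prism when the other half is
small and has an uncovered vertex lying over every crossing edge. -/
theorem extends_of_half (hn : 2 ≤ n) (hB : ExtendsWithEdge (hypercubeGraph n) (2 * n))
    {m : Bool × (Fin n → Bool) → Bool × (Fin n → Bool)}
    (hm : IsPartial (prism (hypercubeGraph n)) m) {f r : (Fin n → Bool) → Fin n → Bool}
    (h : HamPair (hypercubeGraph n) f r) (hc : ContainsMatching f r (half m false))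
    (hcard : movedCard (half m true) ≤ 2 * n) {v : Fin n → Bool} (hv : half m true v = v)
    (hcross : ∀ b x, m (b, x) = (!b, x) → x = v) :
    ∃ F R, HamPair (prism (hypercubeGraph n)) F R ∧ ContainsMatching F R m := by
  obtain ⟨y, hy, hne⟩ := h.exists_edge_ne (two_lt_card_cube hn) v (half m false v)
  have hadj := h.edgeOf_adj hy
  obtain ⟨f', r', h', hc', hy'⟩ := hB _ v y (hm.half true) hcard hv hadj
  obtain ⟨F, R, h1, h2, -⟩ := merge_containing hm h h' hc hc' hy hy' hne.symm
    (by rw [hv]; exact hadj.ne) hcross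
  exact ⟨F, R, h1, h2⟩

/-- The first half may be one edge too large for induction and meets the single edge `ab` of the
second half at `a`. Its edge `aa'` is dropped before applying `hA`. If the cycle happens to contain
`aa'`, merging works; otherwise the cycle is rotated at `aa'` and the path obtained is closed up
along a matching of the second half through `ab`. -/
theorem extends_prism_one_edge (hn : 3 ≤ n)
    (hA : ExtendsMatchings (hypercubeGraph n) (4 * n - 2))
    (hB : ExtendsWithEdge (hypercubeGraph n) (2 * n))
    {m : Bool × (Fin n → Bool) → Bool × (Fin n → Bool)}
    (hm : IsPartial (prism (hypercubeGraph n)) m) (hnc : ∀ b x, m (b, x) ≠ (!b, x))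
    (h0 : movedCard (half m false) ≤ 4 * n) {a b : Fin n → Bool} (hab : a ≠ b)
    (h1 : half m true a = b) (h1' : ∀ x, half m true x ≠ x → x = a ∨ x = b)
    (hcard : movedCard (half m true) ≤ 2)
    (ha : half m false a ≠ a) :
    ∃ F R, HamPair (prism (hypercubeGraph n)) F R ∧ ContainsMatching F R m := by
  set m0 := half m false with hm0
  have hm0p : IsPartial (hypercubeGraph n) m0 := hm.half false
  have hm1p := hm.half true
  have h1b : half m true b = a := by rw [← h1, hm1p.inv]
  have hadj : (hypercubeGraph n).Adj a b := by
    have := hm1p.adj a (by rw [h1]; exact hab.symm)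
    rwa [h1] at this
  have hW := two_lt_card_cube (n := n) (by omega)
  set a' := m0 a with ha'def
  have hadj' : (hypercubeGraph n).Adj a a' := hm0p.adj a ha
  have hma' : m0 a' = a := hm0p.inv a
  obtain ⟨f, r, hfr, hc⟩ := hA (removePair m0 a) (hm0p.removePair a)
    (by have := movedCard_removePair hm0p.inv ha; omega)
  have hc' : ∀ x, x ≠ a → x ≠ a' → m0 x ≠ x → EdgeOf f r x (m0 x) := by
    intro x e1 e2 e3
    have e4 : removePair m0 a x = m0 x := by
      unfold removePair
      rw [if_neg]
      rintro (e | e)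
      · exact e1 e
      · exact e2 e
    have := hc x (by rw [e4]; exact e3)
    rwa [e4] at this
  by_cases he : EdgeOf f r a a'
  · have hcm : ContainsMatching f r m0 := by
      intro x hx
      by_cases e1 : x = a
      · rw [e1]; exact he
      by_cases e2 : x = a'
      · rw [e2, hma']; exact hfr.edge_symm he
      exact hc' x e1 e2 hx
    obtain ⟨v, -, hv⟩ := exists_fixed_ne (m := half m true) (T := ∅) (by
      rw [Finset.card_empty]; omega)
    exact extends_of_half (by omega) hB hm hfr hcm (by omega) hv
      (fun c x e => absurd e (hnc c x))
  obtain ⟨col, hcol⟩ := exists_coloring n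
  -- The rotation deletes one cycle edge at `a`, and its other end must not be `b`. Two edges are
  -- available, so interchanging `f` and `r` suffices.
  wlog hfa : f a ≠ b generalizing f r with H
  · have : r a ≠ b := fun e => hfr.ne hW a ((not_not.1 hfa).trans e.symm)
    exact H r f hfr.symm hc.swap (fun x e1 e2 e3 => (hc' x e1 e2 e3).swap)
      (fun e => he e.swap) this
  have hcf : ∀ x y, (hypercubeGraph n).Adj x y → col y = !col x :=
    fun x y hxy => Bool.eq_not.2 (hcol x y hxy).symm
  have c1 := hcf _ _ hadj
  have c2 := hcf _ _ hadj'
  have c3 := hcf _ _ (hfr.adj_left a)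
  have c4 := hcf _ _ (hfr.adj_right a')
  have e1 : r a' ≠ a := fun e => he (hfr.edge_symm (Or.inr e))
  -- The path ends `f a` and `r a'` have opposite colors. The latter has the color of `a`, hence
  -- differs from `b`; it differs from `a` because `aa'` is not on the cycle.
  obtain ⟨g, hg, hgfix, hgab⟩ := exists_matching_missing_two (x := f a) (y := r a') hcol hadj
    (by rw [c3, c4, c2]; simp) (hfr.adj_left a).ne' hfa e1
    (by intro e; rw [e, c1, c2] at c4; simp at c4)
  obtain ⟨F, R, hFR, g1, g2, g3⟩ := exists_hamPair_rotation (completable_hypercubeGraph n) hfr hcol hadj' he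
    hg hgfix
  have hgba : g b = a := by rw [← hgab, hg.inv]
  refine ⟨F, R, hFR, ?_⟩
  rintro ⟨c, x⟩ hx
  have e2 : m (c, x) = (c, half m c x) :=
    (hm.prism_cases c x).resolve_right (fun e => hnc c x e.1)
  rw [e2] at hx ⊢
  have hx' : half m c x ≠ x := by simpa using hx
  cases c
  · change m0 x ≠ x at hx'
    change EdgeOf F R (false, x) (false, m0 x)
    by_cases x1 : x = a
    · rw [x1]; exact g1
    by_cases x2 : x = a'
    · rw [x2, hma']; exact hFR.edge_symm g1
    refine g2 x (m0 x) (hc' x x1 x2 hx') (fun e => x1 e.1) ?_ (fun e => x2 e.1) ?_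
    · rintro ⟨-, e⟩
      exact x2 (by rw [ha'def, ← e, hm0p.inv])
    · rintro ⟨-, e⟩
      exact x1 (by rw [← hma', ← e, hm0p.inv])
  · rcases h1' x hx' with e | e
    · rw [e, h1, ← hgab]; exact g3 a (by rw [hgab]; exact hab.symm)
    · rw [e, h1b, ← hgba]; exact g3 b (by rw [hgba]; exact hab)

/-- When the fuller half covers at most `4n - 2` vertices, the other covers at most `2n` by parity,
and the halves can be merged. Otherwise the fuller half covers at least `4n`, so at most two covered
vertices remain: either the second half is empty, or it is one edge `ab` and nothing crosses. The
free edge `ab` can be copied; an edge touching the first half calls for rotation. -/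
theorem extends_prism_matching (hn : 3 ≤ n)
    (hA : ExtendsMatchings (hypercubeGraph n) (4 * n - 2))
    (hB : ExtendsWithEdge (hypercubeGraph n) (2 * n))
    {m : Bool × (Fin n → Bool) → Bool × (Fin n → Bool)}
    (hm : IsPartial (prism (hypercubeGraph n)) m) (hcard : movedCard m ≤ 4 * n + 2)
    (hcc : crossCard m ≤ 3) (hle : movedCard (half m true) ≤ movedCard (half m false)) :
    ∃ F R, HamPair (prism (hypercubeGraph n)) F R ∧ ContainsMatching F R m := by
  have hsum := hm.movedCard_eq
  have hp0 := hm.half false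
  have hp1 := hm.half true
  obtain ⟨k0, hk0⟩ := even_movedCard hp0.inv
  obtain ⟨k1, hk1⟩ := even_movedCard hp1.inv
  by_cases hbig : movedCard (half m false) ≤ 4 * n - 2
  · obtain ⟨f, r, hfr, hc⟩ := hA _ hp0 hbig
    by_cases hx : ∃ b x, m (b, x) = (!b, x)
    · obtain ⟨b, v, hv⟩ := hx
      have h2 := two_le_crossCard hm hv
      refine extends_of_half (v := v) (by omega) hB hm hfr hc (by omega) ?_
        (fun c x e => crossCard_unique hm hcc e hv)
      simp [half, crossCard_pair hm hv]
    · push Not at hx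
      have hpow := two_mul_add_two_le_two_pow hn
      obtain ⟨v, -, hv⟩ := exists_fixed_ne (m := half m true) (T := ∅) (by
        rw [Finset.card_empty, card_cube]; omega)
      exact extends_of_half (by omega) hB hm hfr hc (by omega) hv
        (fun c x e => absurd e (hx c x))
  · by_cases h10 : movedCard (half m true) = 0
    · have hfix := movedCard_eq_zero h10
      refine extends_of_copies (completable_prism n) hm hp0 ?_ ?_
      · intro b x hx
        cases b
        · rfl
        · exact absurd (hfix x) hx
      · intro b x hx
        simp [half, crossCard_pair hm hx]
    · have h12 : movedCard (half m true) = 2 := by omega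
      have hnc : ∀ b x, m (b, x) ≠ (!b, x) := by
        intro b x e
        have := two_le_crossCard hm e
        omega
      have hexa : ∃ a, half m true a ≠ a := by
        by_contra! hcon
        apply h10
        unfold movedCard
        rw [Finset.card_eq_zero, Finset.filter_eq_empty_iff]
        intro x _
        simpa using hcon x
      obtain ⟨a, ha⟩ := hexa
      set b := half m true a with hb
      have hba : half m true b = a := hp1.inv a
      have hadj : (hypercubeGraph n).Adj a b := hp1.adj a ha
      have honly : ∀ x, half m true x ≠ x → x = a ∨ x = b :=
        fun x hx => movedCard_two hp1.inv h12.le ha hx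
      have hcopy : ∀ g, IsPartial (hypercubeGraph n) g → g a = b →
          (∀ x, half m false x ≠ x → g x = half m false x) →
          ∃ F R, HamPair (prism (hypercubeGraph n)) F R ∧ ContainsMatching F R m := by
        intro g hg hgab hg0
        refine extends_of_copies (completable_prism n) hm hg ?_ (fun c x e => absurd e (hnc c x))
        intro c x hx
        cases c
        · exact hg0 x hx
        · rcases honly x hx with e | e
          · rw [e, hgab]
          · rw [e, hba, ← hgab, hg.inv]
      by_cases h4 : half m false a = a
      · by_cases h5 : half m false b = b
        · refine hcopy _ (hp0.addPair h4 h5 hadj) (by simp [addPair]) ?_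
          intro x hx
          have e1 : x ≠ a := by rintro rfl; exact hx h4
          have e2 : x ≠ b := by intro e; rw [e] at hx; exact hx h5
          simp [addPair, e1, e2]
        · refine extends_prism_one_edge hn hA hB hm hnc (by omega) ha hba
            (fun x hx => (honly x hx).symm) h12.le h5
      · exact extends_prism_one_edge hn hA hB hm hnc (by omega) (Ne.symm ha) hb.symm honly h12.le
          h4

end Steps

/-! ### Induction step with a prescribed extra edge -/

section EdgeStep
variable {n : ℕ}

/-- In the square a vertex has only two neighbors, and `f x`, `r x` are distinct. -/
theorem HamPair.edgeOf_of_adj_square {f r : (Fin 2 → Bool) → Fin 2 → Bool}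
    (h : HamPair (hypercubeGraph 2) f r) {x y : Fin 2 → Bool}
    (hxy : (hypercubeGraph 2).Adj x y) : EdgeOf f r x y := by
  have hadj : ∀ u v : Fin 2 → Bool, (hypercubeGraph 2).Adj u v →
      (u 0 ≠ v 0 ∧ u 1 = v 1) ∨ (u 0 = v 0 ∧ u 1 ≠ v 1) := by
    intro u v huv
    rcases (splitIso 0 false).map_rel_iff.2 huv with ⟨h1, h2⟩ | ⟨h1, h2⟩
    · right
      rw [splitIso_fst, splitIso_fst] at h1
      refine ⟨by simpa using h1, fun e => huv.ne ?_⟩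
      funext i
      fin_cases i
      · simpa using h1
      · exact e
    · left
      rw [splitIso_fst, splitIso_fst] at h1
      exact ⟨by simpa using h1, congrFun h2 0⟩
  have h1 := hadj _ _ hxy
  have h2 := hadj _ _ (h.adj_left x)
  have h3 := hadj _ _ (h.adj_right x)
  have h4 := h.ne (two_lt_card_cube le_rfl) x
  have hext : ∀ u v : Fin 2 → Bool, u 0 = v 0 → u 1 = v 1 → u = v := by
    intro u v e1 e2
    funext i
    fin_cases i
    · exact e1
    · exact e2
  by_contra hcon
  have h5 : f x ≠ y := fun e => hcon (Or.inl e)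
  have h6 : r x ≠ y := fun e => hcon (Or.inr e)
  have h4' := mt (fun e : f x 0 = r x 0 ∧ f x 1 = r x 1 => hext _ _ e.1 e.2) h4
  have h5' := mt (fun e : f x 0 = y 0 ∧ f x 1 = y 1 => hext _ _ e.1 e.2) h5
  have h6' := mt (fun e : r x 0 = y 0 ∧ r x 1 = y 1 => hext _ _ e.1 e.2) h6
  have hb : ∀ a b c : Bool, a ≠ b → a ≠ c → b = c := by decide
  have b1 := hb (x 0) (f x 0) (r x 0)
  have b2 := hb (x 0) (f x 0) (y 0)
  have b3 := hb (x 0) (r x 0) (y 0)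
  have b4 := hb (x 1) (f x 1) (r x 1)
  have b5 := hb (x 1) (f x 1) (y 1)
  have b6 := hb (x 1) (r x 1) (y 1)
  clear hcon h4 h5 h6 hext hadj hxy h hb
  grind

/-- The difficulty is to merge at an edge `vy'` that is different from `wy` as well as outside both
matchings. -/
theorem extends_prism_edge_of_half (hn : 2 ≤ n)
    (hB : ExtendsWithEdge (hypercubeGraph n) (2 * n))
    {m : Bool × (Fin n → Bool) → Bool × (Fin n → Bool)}
    (hm : IsPartial (prism (hypercubeGraph n)) m) (hcc : crossCard m ≤ 3)
    (hcard : movedCard m ≤ 2 * n + 2) (hcard' : movedCard (half m true) ≤ 2 * n)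
    {w y : Fin n → Bool} (hw : m (false, w) = (false, w)) (hy : m (false, y) ≠ (false, y))
    {f r : (Fin n → Bool) → Fin n → Bool}
    (h : HamPair (hypercubeGraph n) f r) (hc : ContainsMatching f r (half m false))
    (hwy : EdgeOf f r w y) :
    ∃ F R, HamPair (prism (hypercubeGraph n)) F R ∧ ContainsMatching F R m ∧
      EdgeOf F R (false, w) (false, y) := by
  have hW := two_lt_card_cube hn
  have hp0 := hm.half false
  have hp1 := hm.half true
  have hadj := h.edgeOf_adj hwy
  have hw0 : half m false w = w := by simp [half, hw]
  have key : ∀ (f' r' : (Fin n → Bool) → Fin n → Bool) (v y' : Fin n → Bool),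
      HamPair (hypercubeGraph n) f' r' →
      ContainsMatching f' r' (half m true) → EdgeOf f r v y' → EdgeOf f' r' v y' →
      half m false v ≠ y' → half m true v ≠ y' → (∀ b x, m (b, x) = (!b, x) → x = v) →
      ¬ (w = v ∧ y = y') → ¬ (w = y' ∧ y = v) →
      ∃ F R, HamPair (prism (hypercubeGraph n)) F R ∧ ContainsMatching F R m ∧
        EdgeOf F R (false, w) (false, y) := by
    intro f' r' v y' h' hc' e1 e2 e3 e4 e5 e6 e7
    obtain ⟨F, R, h1, h2, h3, -⟩ := merge_containing hm h h' hc hc' e1 e2 e3 e4 e5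
    exact ⟨F, R, h1, h2, h3 _ _ hwy e6 e7⟩
  by_cases hx : ∃ b x, m (b, x) = (!b, x)
  · obtain ⟨b, v, hv⟩ := hx
    have hv' := crossCard_pair hm hv
    have hwv : w ≠ v := by
      rintro rfl
      have := hv' false
      rw [hw] at this
      simp at this
    obtain ⟨y', hy', hne⟩ := h.exists_edge_ne hW v w
    have hadj' := h.edgeOf_adj hy'
    have hv1 : half m true v = v := by simp [half, hv']
    obtain ⟨f', r', h', hc', he'⟩ := hB _ v y' hp1 hcard' hv1 hadj'
    exact key f' r' v y' h' hc' hy' he' (by simpa [half, hv'] using hadj'.ne)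
      (by rw [hv1]; exact hadj'.ne) (fun c x e => crossCard_unique hm hcc e hv)
      (fun e => hwv e.1) (fun e => hne e.1.symm)
  · push Not at hx
    have hy0 : half m false y ≠ y := by
      intro e
      rcases hm.prism_cases false y with e1 | ⟨e1, -⟩
      · rw [e] at e1; exact hy e1
      · exact hx _ _ e1
    by_cases hfix : ∃ v, v ≠ y ∧ half m true v = v
    · obtain ⟨v, hvy, hv⟩ := hfix
      -- One forbidden neighbor is enough: at `v = w` only `wy` must be avoided, since `w` is
      -- uncovered; at any other `v ≠ y` only the matching edge.
      obtain ⟨y', hy', hne⟩ := h.exists_edge_ne hW v (if v = w then y else half m false v)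
      have hadj' := h.edgeOf_adj hy'
      obtain ⟨f', r', h', hc', he'⟩ := hB _ v y' hp1 hcard' hv hadj'
      refine key f' r' v y' h' hc' hy' he' ?_ (by rw [hv]; exact hadj'.ne)
        (fun c x e => absurd e (hx c x)) ?_ (fun e => hvy e.2.symm)
      · by_cases hvw : v = w
        · rw [hvw, hw0, ← hvw]; exact hadj'.ne
        · rw [if_neg hvw] at hne; exact hne.symm
      · rintro ⟨e1, e2⟩
        rw [if_pos e1.symm] at hne
        exact hne e2.symm
    -- If every vertex other than `y` is covered in the second half, then `2 ^ n ≤ 2n + 1` forces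
    -- the square. By parity all its four vertices are covered, so the first half has one edge only,
    -- and a vertex `v` off that edge and different from `w` exists. Every edge of the square is on
    -- the cycle, so the same cycle serves both copies.
    · have h1 : Fintype.card (Fin n → Bool) ≤ movedCard (half m true) + 1 := by
        by_contra! hlt
        obtain ⟨v, hv, hv'⟩ := exists_fixed_ne (m := half m true) (T := {y})
          (by rw [Finset.card_singleton]; exact hlt)
        exact hfix ⟨v, by simpa using hv, hv'⟩
      have hn2 : n = 2 := by
        by_contra hne
        have := two_mul_add_two_le_two_pow (n := n) (by omega)
        rw [card_cube] at h1
        omega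
      subst hn2
      rw [card_cube] at h1
      obtain ⟨k, hk⟩ := even_movedCard hp1.inv
      have hsum := hm.movedCard_eq
      obtain ⟨v, hv, -⟩ := exists_fixed_ne (m := (id : (Fin 2 → Bool) → Fin 2 → Bool))
        (T := {w, y, half m false y}) (by
          have h2 := Finset.card_le_three (a := w) (b := y) (c := half m false y)
          have h3 : movedCard (id : (Fin 2 → Bool) → Fin 2 → Bool) = 0 := by simp [movedCard]
          rw [h3, card_cube]
          omega)
      simp only [Finset.mem_insert, Finset.mem_singleton, not_or] at hv
      have hv0 : half m false v = v := by
        by_contra hv0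
        rcases movedCard_two hp0.inv (by omega) hy0 hv0 with e | e
        · exact hv.2.1 e
        · exact hv.2.2 e
      obtain ⟨y', hy', hne⟩ := h.exists_edge_ne hW v (half m true v)
      have hadj' := h.edgeOf_adj hy'
      exact key f r v y' h (fun x hx' => h.edgeOf_of_adj_square (hp1.adj x hx')) hy' hy'
        (by rw [hv0]; exact hadj'.ne) hne.symm (fun c x e => absurd e (hx c x))
        (fun e => hv.1 e.1.symm) (fun e => hv.2.1 e.2.symm)

/-- The missing edge `wy` is a chord of the cycle, at which the cycle is rotated. The edges deleted
are harmless: `w` is uncovered, and at `y` the edge outside the matching is chosen. -/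
theorem extends_prism_edge_one_sided (hn : 2 ≤ n)
    {m : Bool × (Fin n → Bool) → Bool × (Fin n → Bool)}
    (hm : IsPartial (prism (hypercubeGraph n)) m) (hnc : ∀ b x, m (b, x) ≠ (!b, x))
    (h1 : movedCard (half m true) = 0) {w y : Fin n → Bool}
    (hw : half m false w = w) (hy : half m false y ≠ y) (hadj : (hypercubeGraph n).Adj w y)
    {f r : (Fin n → Bool) → Fin n → Bool}
    (h : HamPair (hypercubeGraph n) f r) (hc : ContainsMatching f r (half m false))
    (hwy : ¬ EdgeOf f r w y) :
    ∃ F R, HamPair (prism (hypercubeGraph n)) F R ∧ ContainsMatching F R m ∧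
      EdgeOf F R (false, w) (false, y) := by
  have hW := two_lt_card_cube hn
  have hp0 := hm.half false
  set m0 := half m false with hm0
  wlog hfy : f y = m0 y generalizing f r with H
  · exact H h.symm (fun e => hwy e.swap) hc.swap ((hc y hy).resolve_left hfy)
  obtain ⟨col, hcol⟩ := exists_coloring n
  have hcf : ∀ x y, (hypercubeGraph n).Adj x y → col y = !col x :=
    fun x y hxy => Bool.eq_not.2 (hcol x y hxy).symm
  have c1 := hcf _ _ hadj
  have c3 := hcf _ _ (h.adj_left w)
  have c4 := hcf _ _ (h.adj_right y)
  -- The second half carries no matching edge, so the prescribed edge `w (r w)` is immaterial; it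
  -- only has to avoid the two missing vertices.
  obtain ⟨g, hg, hgfix, -⟩ := exists_matching_missing_two (x := f w) (y := r y) hcol
    (h.adj_right w)
    (by rw [c3, c4, c1]; simp) (h.adj_left w).ne' (h.ne hW w)
    (fun e => hwy (h.edge_symm (Or.inr e))) (fun e => hadj.ne (h.inv_right.injective e.symm))
  obtain ⟨F, R, hFR, g1, g2, -⟩ := exists_hamPair_rotation (completable_hypercubeGraph n) h hcol
    hadj hwy hg hgfix
  refine ⟨F, R, hFR, ?_, g1⟩
  rintro ⟨c, x⟩ hx
  have e2 : m (c, x) = (c, half m c x) :=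
    (hm.prism_cases c x).resolve_right (fun e => hnc c x e.1)
  rw [e2] at hx ⊢
  have hx' : half m c x ≠ x := by simpa using hx
  cases c
  · change m0 x ≠ x at hx'
    change EdgeOf F R (false, x) (false, m0 x)
    refine g2 x (m0 x) (hc x hx') ?_ ?_ ?_ ?_
    · rintro ⟨e, -⟩
      rw [e] at hx'; exact hx' hw
    · rintro ⟨-, e⟩
      apply hx'
      have e3 : x = w := by rw [← hw, ← e, hp0.inv]
      rw [e3, hw]
    · rintro ⟨e3, e4⟩
      rw [e3, ← hfy] at e4
      exact h.ne hW y e4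
    · rintro ⟨e3, e4⟩
      have e5 : x = m0 y := by rw [← e4, hp0.inv]
      rw [e5, ← hfy] at e3
      exact h.ne hW y e3
  · exact absurd (movedCard_eq_zero h1 x) hx'

theorem extends_prism_edge (hn : 2 ≤ n)
    (hA : ExtendsMatchings (hypercubeGraph n) (4 * n - 2))
    (hB : ExtendsWithEdge (hypercubeGraph n) (2 * n))
    {m : Bool × (Fin n → Bool) → Bool × (Fin n → Bool)}
    (hm : IsPartial (prism (hypercubeGraph n)) m) (hcard : movedCard m ≤ 2 * n + 2)
    {w y : Bool × (Fin n → Bool)} (hw : m w = w) (hy : m y ≠ y)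
    (hadj : (prism (hypercubeGraph n)).Adj w y)
    (hcc : crossCard m + (if w.1 ≠ y.1 then 2 else 0) ≤ 3) (hyf : y.1 = false) :
    ∃ F R, HamPair (prism (hypercubeGraph n)) F R ∧ ContainsMatching F R m ∧ EdgeOf F R w y := by
  obtain ⟨c, y⟩ := y
  obtain ⟨b, w⟩ := w
  simp only at hyf
  subst hyf
  have hp0 := hm.half false
  have hp1 := hm.half true
  have hsum := hm.movedCard_eq
  obtain ⟨k0, hk0⟩ := even_movedCard hp0.inv
  obtain ⟨k1, hk1⟩ := even_movedCard hp1.inv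
  have hy' : half m false y ≠ y ∨ 2 ≤ crossCard m := by
    rcases hm.prism_cases false y with e | ⟨e, -⟩
    · left; intro e1; rw [e1] at e; exact hy e
    · right; exact two_le_crossCard hm e
  -- The matching edge at `y` lies in the first half or crosses; either way it accounts for two of
  -- the `2n + 2` covered vertices.
  have hk : movedCard (half m true) ≤ 2 * n := by
    rcases hy' with e | e
    · have := two_le_movedCard hp0.inv e
      omega
    · omega
  cases b
  · have hadj0 : (hypercubeGraph n).Adj w y := by
      rcases hadj with e | e
      · exact e.2
      · exact absurd rfl e.1
    have hw0 : half m false w = w := by simp [half, hw]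
    have hcc' : crossCard m ≤ 3 := by omega
    by_cases hk0' : movedCard (half m false) ≤ 2 * n
    · obtain ⟨f, r, h, hc, he⟩ := hB _ w y hp0 hk0' hw0 hadj0
      exact extends_prism_edge_of_half hn hB hm hcc' hcard hk hw hy h hc he
    · obtain ⟨f, r, h, hc⟩ := hA _ hp0 (by omega)
      by_cases he : EdgeOf f r w y
      · exact extends_prism_edge_of_half hn hB hm hcc' hcard hk hw hy h hc he
      · have hnc : ∀ b x, m (b, x) ≠ (!b, x) := by
          intro b x e
          have := two_le_crossCard hm e
          omega
        exact extends_prism_edge_one_sided hn hm hnc (by omega) hw0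
          (hy'.resolve_right (by omega)) hadj0 h hc he
  · simp only [ne_eq, Bool.true_eq_false, not_false_eq_true, if_true] at hcc
    have hwy : w = y := by
      rcases hadj with e | e
      · exact absurd e.1 (by simp)
      · exact e.2
    subst hwy
    have hy0 := hy'.resolve_right (by omega)
    have hnc : ∀ b x, m (b, x) ≠ (!b, x) := by
      intro b x e
      have := two_le_crossCard hm e
      omega
    obtain ⟨f, r, h, hc⟩ := hA _ hp0 (by omega)
    -- The prescribed edge is vertical, so merging at its column produces it.
    obtain ⟨y', hy', hne⟩ := h.exists_edge_ne (two_lt_card_cube hn) w (half m false w)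
    have hadj' := h.edgeOf_adj hy'
    have hv1 : half m true w = w := by simp [half, hw]
    obtain ⟨f', r', h', hc', he'⟩ := hB _ w y' hp1 hk hv1 hadj'
    obtain ⟨F, R, h1, h2, -, h3⟩ := merge_containing hm h h' hc hc' hy' he' hne.symm
      (by rw [hv1]; exact hadj'.ne) (fun c x e => absurd e (hnc c x))
    exact ⟨F, R, h1, h2, h3 true⟩

end EdgeStep

/-! ### Choosing a direction and running the induction -/

section Induction
variable {n : ℕ}

theorem movedCard_conj {V W : Type*} [Fintype V] [Fintype W] [DecidableEq V] [DecidableEq W]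
    (e : V ≃ W) (m : V → V) : movedCard (e ∘ m ∘ e.symm) = movedCard m := by
  unfold movedCard
  refine (Finset.card_equiv e ?_).symm
  intro x
  simp

theorem crossCard_split (i : Fin (n + 1)) (b : Bool)
    (m : (Fin (n + 1) → Bool) → Fin (n + 1) → Bool) :
    crossCard (splitIso i b ∘ m ∘ (splitIso i b).symm) =
      (Finset.univ.filter fun v => m v i ≠ v i).card := by
  unfold crossCard
  refine (Finset.card_equiv (splitIso i b).toEquiv ?_).symm
  intro x
  have h1 : (splitIso i b).symm ((splitIso i b) x) = x := RelIso.symm_apply_apply _ _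
  rw [Finset.mem_filter, Finset.mem_filter, RelIso.coe_fn_toEquiv, comp_apply, comp_apply, h1,
    splitIso_fst, splitIso_fst]
  simp

/-- Reversing the order of the halves allows the fuller one to be taken first. -/
theorem half_split (i : Fin (n + 1)) (m : (Fin (n + 1) → Bool) → Fin (n + 1) → Bool) (c : Bool) :
    half (splitIso i true ∘ m ∘ (splitIso i true).symm) c =
      half (splitIso i false ∘ m ∘ (splitIso i false).symm) (!c) := by
  funext x
  have h1 : (splitIso i true).symm (c, x) = (splitIso i false).symm (!c, x) := by
    apply (splitIso i true).injective
    rw [RelIso.apply_symm_apply]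
    refine Prod.ext ?_ ?_
    · simp [splitIso]
    · simp [splitIso]
  have h2 : ∀ v, (splitIso i true v).1 = !(splitIso i false v).1 := fun v => by
    simp [splitIso_fst]
  have h3 : ∀ v, (splitIso i true v).2 = (splitIso i false v).2 := fun v => rfl
  unfold half
  simp only [comp_apply, h1, h2, h3]
  congr 1
  cases c <;> simp

theorem sum_direction {m : (Fin n → Bool) → Fin n → Bool} (hm : IsPartial (hypercubeGraph n) m) :
    ∑ i, (Finset.univ.filter fun v => m v i ≠ v i).card = movedCard m := by
  unfold movedCard
  simp only [Finset.card_filter]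
  rw [Finset.sum_comm]
  refine Finset.sum_congr rfl (fun v _ => ?_)
  rw [← Finset.card_filter]
  split_ifs with h
  · have h1 : hammingDist v (m v) = 1 := hm.adj v h
    rw [hammingDist_comm] at h1
    exact h1
  · push Not at h
    simp [h]

/-- Each covered vertex belongs to exactly one direction. If every direction had four, there would
be at least `4n + 4` of them. -/
theorem exists_direction {m : (Fin (n + 1) → Bool) → Fin (n + 1) → Bool}
    (hm : IsPartial (hypercubeGraph (n + 1)) m) (hcard : movedCard m ≤ 4 * n + 2) :
    ∃ i, (Finset.univ.filter fun v => m v i ≠ v i).card ≤ 3 := by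
  have h : ∑ i, (Finset.univ.filter fun v => m v i ≠ v i).card < ∑ _i : Fin (n + 1), 4 := by
    rw [sum_direction hm, Finset.sum_const, Finset.card_univ, Fintype.card_fin, smul_eq_mul]
    omega
  obtain ⟨i, -, hi⟩ := Finset.exists_lt_of_sum_lt h
  exact ⟨i, by omega⟩

/-- The same averaging with `wy` counted as two further vertices: the total `2n + 4` is below `4(n +
1)`. -/
theorem exists_direction_edge (hn : 1 ≤ n) {m : (Fin (n + 1) → Bool) → Fin (n + 1) → Bool}
    (hm : IsPartial (hypercubeGraph (n + 1)) m) (hcard : movedCard m ≤ 2 * n + 2)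
    {w y : Fin (n + 1) → Bool} (hwy : (hypercubeGraph (n + 1)).Adj w y) :
    ∃ i, (Finset.univ.filter fun v => m v i ≠ v i).card + (if w i ≠ y i then 2 else 0) ≤ 3 := by
  have h1 : ∑ i, (if w i ≠ y i then 2 else 0) = 2 := by
    rw [← Finset.sum_filter, Finset.sum_const]
    have : (Finset.univ.filter fun i => w i ≠ y i).card = 1 := hwy
    rw [this]
    rfl
  have h : ∑ i, ((Finset.univ.filter fun v => m v i ≠ v i).card + (if w i ≠ y i then 2 else 0)) <
      ∑ _i : Fin (n + 1), 4 := by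
    rw [Finset.sum_add_distrib, sum_direction hm, h1, Finset.sum_const, Finset.card_univ,
      Fintype.card_fin, smul_eq_mul]
    omega
  obtain ⟨i, -, hi⟩ := Finset.exists_lt_of_sum_lt h
  exact ⟨i, by omega⟩

theorem ContainsMatching.conj {V W : Type*} (e : V ≃ W) {F R : W → W} {m : V → V}
    (h : ContainsMatching F R (e ∘ m ∘ e.symm)) :
    ContainsMatching (e.symm ∘ F ∘ e) (e.symm ∘ R ∘ e) m := by
  intro x hx
  apply EdgeOf.conj
  have := h (e x)
  simpa [hx] using this

theorem extendsMatchings_square (k : ℕ) : ExtendsMatchings (hypercubeGraph 2) k := by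
  intro m hm _
  obtain ⟨f, r, h⟩ := exists_hamPair 1
  exact ⟨f, r, h, fun x hx => h.edgeOf_of_adj_square (hm.adj x hx)⟩

theorem extendsWithEdge_square (k : ℕ) : ExtendsWithEdge (hypercubeGraph 2) k := by
  intro m w y hm _ _ hwy
  obtain ⟨f, r, h⟩ := exists_hamPair 1
  exact ⟨f, r, h, fun x hx => h.edgeOf_of_adj_square (hm.adj x hx), h.edgeOf_of_adj_square hwy⟩

/-- Dimension three is separate because a half may be covered entirely, leaving no place to merge. A
perfect matching falls to Fink's theorem. Otherwise an uncovered vertex is available, and the square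
imposes no condition on the edges. -/
theorem extendsMatchings_cube : ExtendsMatchings (hypercubeGraph 3) 10 := by
  intro m hm hcard
  by_cases hfix : ∀ x, m x ≠ x
  · obtain ⟨r, h1, h2, h3⟩ := completable_hypercubeGraph 3 m hm.inv hfix
    exact ⟨m, r, ⟨hm.inv, h1, fun x => hm.adj x (hfix x), h2, h3⟩, fun x _ => Or.inl rfl⟩
  push Not at hfix
  obtain ⟨v, hv⟩ := hfix
  obtain ⟨i, hi⟩ := exists_direction hm hcard
  -- This choice puts the uncovered vertex `v` in the second copy.
  let e := splitIso i (!v i)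
  have hM : IsPartial (prism (hypercubeGraph 2)) (e ∘ m ∘ e.symm) := hm.conj e.symm
  have hcc : crossCard (e ∘ m ∘ e.symm) ≤ 3 := by rw [crossCard_split]; exact hi
  obtain ⟨f, r, hfr, hc⟩ := extendsMatchings_square _ _ (hM.half false) le_rfl
  have h1 : movedCard (half (e ∘ m ∘ e.symm) true) ≤ 2 * 2 :=
    (Finset.card_le_univ _).trans (by simp)
  suffices ∃ F R, HamPair (prism (hypercubeGraph 2)) F R ∧
      ContainsMatching F R (e ∘ m ∘ e.symm) by
    obtain ⟨F, R, hFR, hc⟩ := this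
    exact ⟨_, _, hFR.conj e, ContainsMatching.conj e.toEquiv hc⟩
  by_cases hx : ∃ b x, (e ∘ m ∘ e.symm) (b, x) = (!b, x)
  · obtain ⟨b, x, hbx⟩ := hx
    exact extends_of_half le_rfl (extendsWithEdge_square _) hM hfr hc h1 (v := x)
      (by simp only [half, crossCard_pair hM hbx]; simp)
      (fun c z hz => crossCard_unique hM hcc hz hbx)
  · push Not at hx
    have hev : e v = (true, (e v).2) := Prod.ext (by simp [e, splitIso_fst]) rfl
    have hMv : (e ∘ m ∘ e.symm) (true, (e v).2) = (true, (e v).2) := by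
      rw [← hev]; simp [hv]
    exact extends_of_half le_rfl (extendsWithEdge_square _) hM hfr hc h1 (v := (e v).2)
      (by simp only [half, hMv]; simp) (fun c z hz => absurd hz (hx c z))

theorem ExtendsMatchings.succ (hn : 2 ≤ n)
    (hA : ExtendsMatchings (hypercubeGraph n) (4 * n - 2))
    (hB : ExtendsWithEdge (hypercubeGraph n) (2 * n)) :
    ExtendsMatchings (hypercubeGraph (n + 1)) (4 * (n + 1) - 2) := by
  rcases hn.eq_or_lt with rfl | hn
  · exact extendsMatchings_cube
  intro m hm hcard
  obtain ⟨i, hi⟩ := exists_direction hm (by omega)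
  have key : ∀ b, movedCard (half (splitIso i b ∘ m ∘ (splitIso i b).symm) true) ≤
      movedCard (half (splitIso i b ∘ m ∘ (splitIso i b).symm) false) →
      ∃ f r, HamPair (hypercubeGraph (n + 1)) f r ∧ ContainsMatching f r m := by
    intro b hb
    have hM : IsPartial (prism (hypercubeGraph n)) (splitIso i b ∘ m ∘ (splitIso i b).symm) :=
      hm.conj (splitIso i b).symm
    obtain ⟨F, R, hFR, hc⟩ := extends_prism_matching hn hA hB hM
      (by have := movedCard_conj (splitIso i b).toEquiv m
          change movedCard (splitIso i b ∘ m ∘ (splitIso i b).symm) = _ at this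
          omega)
      (by rw [crossCard_split]; exact hi) hb
    exact ⟨_, _, hFR.conj (splitIso i b), ContainsMatching.conj (splitIso i b).toEquiv hc⟩
  rcases le_total (movedCard (half (splitIso i false ∘ m ∘ (splitIso i false).symm) true))
    (movedCard (half (splitIso i false ∘ m ∘ (splitIso i false).symm) false)) with h | h
  · exact key false h
  · refine key true ?_
    rw [half_split, half_split]
    exact h

/-- If `y` is uncovered, adding `wy` gives a matching covering at most `2n + 4 ≤ 4n + 2` vertices,
within the bound just proved in the same dimension. Only a covered `y` requires splitting. -/
theorem ExtendsWithEdge.succ (hn : 2 ≤ n)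
    (hA' : ExtendsMatchings (hypercubeGraph (n + 1)) (4 * (n + 1) - 2))
    (hA : ExtendsMatchings (hypercubeGraph n) (4 * n - 2))
    (hB : ExtendsWithEdge (hypercubeGraph n) (2 * n)) :
    ExtendsWithEdge (hypercubeGraph (n + 1)) (2 * (n + 1)) := by
  intro m w y hm hcard hw hwy
  by_cases hy : m y = y
  · obtain ⟨f, r, hfr, hc⟩ := hA' _ (hm.addPair hw hy hwy)
      (by have := movedCard_addPair_le m w y; omega)
    refine ⟨f, r, hfr, fun x hx => ?_, ?_⟩
    · have e1 : x ≠ w := by rintro rfl; exact hx hw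
      have e2 : x ≠ y := by rintro rfl; exact hx hy
      have e3 : addPair m w y x = m x := by simp [addPair, e1, e2]
      have := hc x (by rw [e3]; exact hx)
      rwa [e3] at this
    · have e3 : addPair m w y w = y := by simp [addPair]
      have := hc w (by rw [e3]; exact hwy.ne')
      rwa [e3] at this
  obtain ⟨i, hi⟩ := exists_direction_edge (by omega) hm hcard hwy
  let e := splitIso i (y i)
  have hM : IsPartial (prism (hypercubeGraph n)) (e ∘ m ∘ e.symm) := hm.conj e.symm
  have hc1 := movedCard_conj e.toEquiv m
  change movedCard (e ∘ m ∘ e.symm) = _ at hc1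
  obtain ⟨F, R, hFR, hc, he⟩ := extends_prism_edge hn hA hB hM (by omega) (w := e w) (y := e y)
    (by simp [hw])
    (by intro h
        apply hy
        simpa using h)
    (e.map_rel_iff.2 hwy)
    (by rw [crossCard_split]
        have : (e w).1 ≠ (e y).1 ↔ w i ≠ y i := by
          simp only [e, splitIso_fst, ne_eq, Bool.xor_right_inj]
        simp only [this]
        exact hi)
    (by simp [e, splitIso_fst])
  exact ⟨_, _, hFR.conj e, ContainsMatching.conj e.toEquiv hc, EdgeOf.conj e.toEquiv he⟩

theorem extends_hypercubeGraph (hn : 2 ≤ n) :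
    ExtendsMatchings (hypercubeGraph n) (4 * n - 2) ∧
      ExtendsWithEdge (hypercubeGraph n) (2 * n) := by
  induction n, hn using Nat.le_induction with
  | base => exact ⟨extendsMatchings_square _, extendsWithEdge_square _⟩
  | succ n hn ih =>
    have h := ExtendsMatchings.succ hn ih.1 ih.2
    exact ⟨h, ExtendsWithEdge.succ hn h ih.1 ih.2⟩

end Induction

/-! ### From permutations to walks, and from edge sets to involutions -/

section Walks
variable {V : Type*} {G : SimpleGraph V}

/-- The walk following `s` for `k` steps. -/
def iterateWalk (s : V → V) (hs : ∀ x, G.Adj x (s x)) : (k : ℕ) → (a : V) → G.Walk a (s^[k] a)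
  | 0, _ => SimpleGraph.Walk.nil
  | k + 1, a => SimpleGraph.Walk.cons (hs a) (iterateWalk s hs k (s a))

theorem support_iterateWalk (s : V → V) (hs : ∀ x, G.Adj x (s x)) (k : ℕ) (a : V) :
    (iterateWalk s hs k a).support = List.iterate s a (k + 1) := by
  induction k generalizing a with
  | zero => rfl
  | succ k ih =>
    have h := SimpleGraph.Walk.support_cons (hs a) (iterateWalk s hs k (s a))
    rw [ih] at h
    exact h

theorem length_iterateWalk (s : V → V) (hs : ∀ x, G.Adj x (s x)) (k : ℕ) (a : V) :
    (iterateWalk s hs k a).length = k := by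
  induction k generalizing a with
  | zero => rfl
  | succ k ih =>
    have h := SimpleGraph.Walk.length_cons (hs a) (iterateWalk s hs k (s a))
    rw [ih] at h
    exact h

theorem mem_edges_iterateWalk (s : V → V) (hs : ∀ x, G.Adj x (s x)) (k : ℕ) (a : V) (e : Sym2 V) :
    e ∈ (iterateWalk s hs k a).edges ↔ ∃ j < k, e = s(s^[j] a, s^[j + 1] a) := by
  induction k generalizing a with
  | zero => simp [iterateWalk]
  | succ k ih =>
    have h0 : (iterateWalk s hs (k + 1) a).edges =
        s(a, s a) :: (iterateWalk s hs k (s a)).edges :=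
      SimpleGraph.Walk.edges_cons (hs a) (iterateWalk s hs k (s a))
    rw [h0, List.mem_cons, ih]
    constructor
    · rintro (h | ⟨j, hj, h⟩)
      · exact ⟨0, by omega, h⟩
      · exact ⟨j + 1, by omega, h⟩
    · rintro ⟨j, hj, h⟩
      rcases j with _ | j
      · exact Or.inl h
      · exact Or.inr ⟨j, by omega, h⟩

theorem minimalPeriod_eq_card [Fintype V] (s : Equiv.Perm V)
    (hs : ∀ S : Set V, S.Nonempty → Set.MapsTo s S S → S = Set.univ) (a : V) :
    minimalPeriod s a = Fintype.card V := by
  have hall : ∀ y, ∃ j, s^[j] a = y := by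
    have : {y | ∃ j, s^[j] a = y} = Set.univ := by
      refine hs _ ⟨a, 0, rfl⟩ ?_
      rintro y ⟨j, hj⟩
      exact ⟨j + 1, by rw [Function.iterate_succ_apply', hj]⟩
    intro y
    have h : y ∈ {y | ∃ j, s^[j] a = y} := by rw [this]; trivial
    exact h
  have hper : a ∈ periodicPts s := s.injective.mem_periodicPts a
  have hpos := minimalPeriod_pos_of_mem_periodicPts hper
  have hbij : Bijective (fun j : Fin (minimalPeriod s a) => s^[j] a) := by
    constructor
    · intro j k hjk
      exact Fin.ext (iterate_injOn_Iio_minimalPeriod j.2 k.2 hjk)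
    · intro y
      obtain ⟨j, hj⟩ := hall y
      refine ⟨⟨j % minimalPeriod s a, Nat.mod_lt _ hpos⟩, ?_⟩
      rw [← hj]
      exact iterate_mod_minimalPeriod_eq
  have := Fintype.card_of_bijective hbij
  rwa [Fintype.card_fin] at this

/-- The permutation following a Hamiltonian cycle yields that cycle as a walk. -/
theorem exists_isHamiltonianCycle [Fintype V] [DecidableEq V] (s : Equiv.Perm V)
    (hs : ∀ S : Set V, S.Nonempty → Set.MapsTo s S S → S = Set.univ)
    (hadj : ∀ x, G.Adj x (s x)) (hV : 2 < Fintype.card V) (a : V) :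
    ∃ C : G.Walk a a, C.IsHamiltonianCycle ∧ ∀ x, s(x, s x) ∈ C.edges := by
  have hmp := minimalPeriod_eq_card s hs
  obtain ⟨k, hk⟩ : ∃ k, Fintype.card V = k + 1 := ⟨Fintype.card V - 1, by omega⟩
  have hinj : ∀ x i j, i < k + 1 → j < k + 1 → s^[i] x = s^[j] x → i = j := by
    intro x i j hi hj hij
    rw [← hk, ← hmp x] at hi hj
    exact iterate_injOn_Iio_minimalPeriod hi hj hij
  have hend : s^[k] (s a) = a := by
    have := iterate_minimalPeriod (f := s) (x := a)
    rw [hmp, hk] at this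
    exact this
  refine ⟨SimpleGraph.Walk.cons (hadj a) ((iterateWalk s hadj k (s a)).copy rfl hend), ?_, ?_⟩
  · rw [SimpleGraph.Walk.isHamiltonianCycle_iff_isCycle_and_length_eq]
    constructor
    · rw [SimpleGraph.Walk.cons_isCycle_iff]
      constructor
      · rw [SimpleGraph.Walk.isPath_copy, SimpleGraph.Walk.isPath_def, support_iterateWalk,
          ← List.range_map_iterate]
        refine List.Nodup.map_on ?_ List.nodup_range
        intro i hi j hj hij
        exact hinj (s a) i j (List.mem_range.1 hi) (List.mem_range.1 hj) hij
      · rw [SimpleGraph.Walk.edges_copy, mem_edges_iterateWalk]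
        rintro ⟨j, hj, he⟩
        rcases Sym2.eq_iff.1 he with ⟨h1, h2⟩ | ⟨h1, h2⟩
        · have := hinj a 0 (j + 1) (by omega) (by omega) h1
          omega
        -- The closing edge traversed backwards would give `s (s a) = a`, impossible with more than
        -- two vertices.
        · have h3 := hinj (s a) 0 j (by omega) (by omega) h2
          subst h3
          have := hinj a 0 2 (by omega) (by omega) h1
          omega
    · simp [length_iterateWalk, hk]
  · intro x
    obtain ⟨j, hj⟩ : ∃ j, s^[j] a = x := by
      have : {y | ∃ j, s^[j] a = y} = Set.univ := by
        refine hs _ ⟨a, 0, rfl⟩ ?_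
        rintro y ⟨j, hj⟩
        exact ⟨j + 1, by rw [Function.iterate_succ_apply', hj]⟩
      have h : x ∈ {y | ∃ j, s^[j] a = y} := by rw [this]; trivial
      exact h
    have hj' : s^[j % (k + 1)] a = x := by
      rw [← hj, ← hk, ← hmp a]
      exact iterate_mod_minimalPeriod_eq
    have hlt : j % (k + 1) < k + 1 := Nat.mod_lt j (Nat.succ_pos k)
    rw [SimpleGraph.Walk.edges_cons, List.mem_cons, SimpleGraph.Walk.edges_copy,
      mem_edges_iterateWalk]
    rcases h : j % (k + 1) with _ | i
    · rw [h] at hj'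
      left
      rw [← hj']; rfl
    · rw [h] at hj'
      right
      refine ⟨i, by omega, ?_⟩
      rw [← hj', ← Function.iterate_succ_apply' s]
      rfl

/-- The partner map of a matching given as a set of edges. -/
theorem exists_partnerMap [Fintype V] [DecidableEq V] {M : Finset (Sym2 V)}
    (hM : IsEdgeMatching G M) :
    ∃ m : V → V, IsPartial G m ∧ movedCard m ≤ 2 * M.card ∧
      ∀ x y, s(x, y) ∈ M → m x ≠ x ∧ m x = y := by
  classical
  have huniq : ∀ x y z, s(x, y) ∈ M → s(x, z) ∈ M → y = z := by
    intro x y z h1 h2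
    by_contra hyz
    refine hM.2 _ h1 _ h2 ?_ x (by simp) (by simp)
    intro e
    exact hyz (Sym2.congr_right.1 e)
  let m : V → V := fun x => if h : ∃ y, s(x, y) ∈ M then h.choose else x
  have hm1 : ∀ x y, s(x, y) ∈ M → m x = y := by
    intro x y hxy
    have h : ∃ y, s(x, y) ∈ M := ⟨y, hxy⟩
    have : m x = h.choose := by simp [m, h]
    rw [this]
    exact huniq x _ _ h.choose_spec hxy
  have hm2 : ∀ x, m x ≠ x → s(x, m x) ∈ M := by
    intro x hx
    by_cases h : ∃ y, s(x, y) ∈ M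
    · obtain ⟨y, hy⟩ := h
      rwa [hm1 x y hy]
    · exact absurd (by simp [m, h]) hx
  refine ⟨m, ⟨?_, ?_⟩, ?_, ?_⟩
  · intro x
    by_cases hx : m x = x
    · rw [hx, hx]
    · have h := hm2 x hx
      rw [Sym2.eq_swap] at h
      exact hm1 _ _ h
  · intro x hx
    exact hM.1 _ (hm2 x hx)
  · have hsub : (Finset.univ.filter fun x => m x ≠ x) ⊆ M.biUnion Sym2.toFinset := by
      intro x hx
      simp only [Finset.mem_filter, Finset.mem_univ, true_and] at hx
      rw [Finset.mem_biUnion]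
      exact ⟨_, hm2 x hx, by simp⟩
    refine (Finset.card_le_card hsub).trans (Finset.card_biUnion_le.trans ?_)
    have hle : ∀ e ∈ M, e.toFinset.card ≤ 2 := by
      intro e _
      rw [Sym2.card_toFinset]
      split_ifs <;> omega
    have := Finset.sum_le_card_nsmul M (fun e => e.toFinset.card) 2 hle
    rw [smul_eq_mul] at this
    omega
  · intro x y hxy
    have h := hm1 x y hxy
    refine ⟨?_, h⟩
    rw [h]
    exact (SimpleGraph.Adj.ne (hM.1 _ hxy)).symm

end Walks
end HypercubeMatching

theorem theorem1 (n : ℕ) (hn : 2 ≤ n) (M : Finset (Sym2 (Fin n → Bool)))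
    (hM : IsEdgeMatching (hypercubeGraph n) M) (hcard : M.card ≤ 2 * n - 1) :
    ∃ (a : Fin n → Bool) (C : (hypercubeGraph n).Walk a a),
      C.IsHamiltonianCycle ∧ ∀ e ∈ M, e ∈ C.edges := by
  obtain ⟨m, hm, hmc, hmM⟩ := HypercubeMatching.exists_partnerMap hM
  obtain ⟨f, r, h, hc⟩ := (HypercubeMatching.extends_hypercubeGraph hn).1 m hm (by omega)
  obtain ⟨col, hcol⟩ := HypercubeMatching.exists_coloring n
  have hadj : ∀ x, (hypercubeGraph n).Adj x (h.perm hcol x) := by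
    intro x
    cases hx : col x
    · simpa [HypercubeMatching.HamPair.perm, hx] using h.adj_right x
    · simpa [HypercubeMatching.HamPair.perm, hx] using h.adj_left x
  obtain ⟨C, hC, hCe⟩ := HypercubeMatching.exists_isHamiltonianCycle (h.perm hcol)
    (fun S hS hS' => h.perm_transitive hcol hS hS') hadj
    (HypercubeMatching.two_lt_card_cube hn) (fun _ => false)
  refine ⟨_, C, hC, ?_⟩
  intro e he
  induction e with
  | _ x y =>
    obtain ⟨h1, h2⟩ := hmM x y he
    have h3 := hc x h1
    rw [h2] at h3
    -- The permutation follows `f` from one color class and `r` from the other, so each edge of the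
    -- pair is traversed from exactly one end.
    have h4 : h.perm hcol x = y ∨ h.perm hcol y = x := by
      have c1 := hcol x y (hM.1 _ he)
      have i1 := h.inv_left x
      have i2 := h.inv_right x
      rcases h3 with h3 | h3 <;> cases hx : col x <;> cases hy : col y <;>
        simp_all [HypercubeMatching.HamPair.perm]
    rcases h4 with h4 | h4
    · rw [← h4]; exact hCe x
    · rw [Sym2.eq_swap, ← h4]; exact hCe y
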